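/- **Setting.** A learner wants to estimate the mean $\mu$ of an unknown distribution $D$ on $\mathbb R$. In each round $t=1,\dots,n$ it chooses (adaptively, possibly using private uniform randomness) a set $Q_t\subseteq\mathbb R$, and it receives only the bit $\mathbf 1\{X_t\in Q_t\}$, where $X_1,X_2,\dots$ are i.i.d. with law $D$. Write $\mathrm{Log}\,x=\max\{1,\ln x\}$. **Main estimator** with parameters $(\epsilon,\delta,\lambda,\sigma)$. (1) *Localization*: a subroutine that asks only threshold queries "$X_t\le s$?", at most $O(\mathrm{Log}(\lambda/\sigma)+\mathrm{Log}(1/\delta))$ of them, returns $[L,U]$ such that, for every $D$ with mean in $[-\lambda,\lambda]$ and variance at most $\sigma^2$, with probability at least $1-\delta/2$ the interval $[L,U]$ contains every median of $D$ and $[L-\sigma,U+\sigma]$ has length at most $6\sigma$. Put $c=(L+U)/2$. (2) *Refinement*: let $m_0=0$, $m_i=2^i$ for $1\le i\le4$, $m_i=2(m_{i-1}-3)$ for $i\ge5$; let $R_i=[m_{i-1}\sigma,m_i\sigma)$ for $i\ge1$ and $R_{-i}=-R_i$, and let $a_i<b_i$ be the endpoints of $R_i$. Let $i_{\max}=\min\{i\ge5:2^{-i}\le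 5\epsilon/(128\sigma)\}$, $\epsilon^{(i)}=\epsilon/(4i_{\max}(|a_i|+|b_i|))$ and $\delta'=\delta/(8i_{\max})$. For each $1\le|i|\le i_{\max}$, take $n_i=\big\lceil\frac{1}{2(\epsilon^{(i)})^2}\ln\frac2{\delta'}\big\rceil$ if $|i|\le4$ and $n_i=\big\lceil\big(\frac{8}{m_{|i|}^2(\epsilon^{(i)})^2}+\frac{2}{3\epsilon^{(i)}}\big)\ln\frac2{\delta'}\big\rceil$ if $|i|\ge5$. Let $\hat p_{a_i}$ be the fraction of positive answers to $n_i$ queries "$X-c\in R_i$ and $X-c\le T$?" and $\hat p_{b_i}$ the fraction of positive answers to $n_i$ queries "$X-c\in R_i$ and $X-c\ge T$?", each query with a fresh sample $X$ and a fresh $T\sim\mathrm{Unif}(a_i,b_i)$. Output $c+\sum_{1\le|i|\le i_{\max}}(a_i\hat p_{a_i}+b_i\hat p_{b_i})$. **Adaptive estimator** with parameters $(r,\delta,\lambda,\sigma_{\min},\sigma_{\max})$. Let $T=\lceil\log_2(\sigma_{\max}/\sigma_{\min})\rceil$ and $\sigma_i=2^i\sigma_{\min}$ for $0\le i\le T$.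 For each $i$, run the main estimator on fresh samples with parameters $(\epsilon_i,\delta_i,\lambda,\sigma_i)=(r\sigma_i/5,\ \delta/(T+1),\ \lambda,\ \sigma_i)$ to get $\hat\mu^{(i)}$, and let $I_i=[\hat\mu^{(i)}-\epsilon_i,\hat\mu^{(i)}+\epsilon_i]$. Call $i$ feasible if $I_i\cap I_j\neq\emptyset$ for all $i<j\le T$. Return $\hat\mu=\hat\mu^{(i^*)}$, where $i^*$ is the smallest feasible index. **Theorem.** There is a localization subroutine as described in (1) such that, for all $0<\sigma_{\min}\le\sigma_{\max}\le\lambda$ and $0<\delta<1$, the following hold. (a) For every $r>0$, the adaptive estimator is $(\epsilon,\delta)$-PAC with $\epsilon=r\sigma_{\rm true}$: for every $D$ with mean $\mu\in[-\lambda,\lambda]$ and standard deviation $\sigma_{\rm true}\in[\sigma_{\min},\sigma_{\max}]$, $$\Pr\big(|\hat\mu-\mu|\le r\,\sigma_{\rm true}\big)\ge1-\delta .$$ (b) For $0<r\le1$, the number $n$ of samples it uses satisfies, with an absolute implied constant, $$n=O\!\left(\frac{\mathrm{Log}\frac{\sigma_{\max}}{\sigma_{\min}}\cdot\mathrm{Log}^3\frac1r}{r^2}\cdot\mathrm{Log}\!\left(\frac{\mathrm{Log}\frac{\sigma_{\max}}{\sigma_{\min}}\cdot\mathrm{Log}\frac1r}{\delta}\right)+\mathrm{Log}\frac{\sigma_{\max}}{\sigma_{\min}}\cdot\mathrm{Log}\frac{\lambda}{\sqrt{\sigma_{\min}\sigma_{\max}}}\right).$$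 (c) In particular, for $0<r\le1$, $n=\widetilde O(B)$, that is, $n\le C\,B\,(\mathrm{Log}\,B)^k$ for absolute constants $C,k$, where $$B=\mathrm{Log}\frac{\sigma_{\max}}{\sigma_{\min}}\left(\frac1{r^2}\mathrm{Log}\frac1\delta+\mathrm{Log}\frac{\lambda}{\sqrt{\sigma_{\min}\sigma_{\max}}}\right).$$ -/

import Mathlib

open MeasureTheory ProbabilityTheory Set

noncomputable section

namespace OneBit

/-! ### Sequential 1-bit protocols -/

/-- A learner that interacts with the agent for exactly `n` rounds and then outputs a value of
type `α`. In each round it receives a fresh private coin `u`, uniform on `[0, 1]`, asks the agent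
whether the fresh sample lies in the set `Q u`, and continues in a way that may depend on the coin
and on the one-bit answer. -/
inductive Protocol (α : Type) : ℕ → Type
  | done (a : α) : Protocol α 0
  | ask {n : ℕ} (Q : unitInterval → Set ℝ) (k : unitInterval → Bool → Protocol α n) :
      Protocol α (n + 1)

namespace Protocol

open Classical in
/-- The output of the learner when `ω t` is the pair (sample, private coin) of round `t`. -/
def run {α : Type} : {n : ℕ} → Protocol α n → (Fin n → ℝ × unitInterval) → α
  | _, done a, _ => a
  | _, ask Q k, ω => (k (ω 0).2 (decide ((ω 0).1 ∈ Q (ω 0).2))).run (Fin.tail ω)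

/-- Every set that the learner may ever ask about belongs to `𝒬`. -/
def UsesOnly {α : Type} (𝒬 : Set (Set ℝ)) : {n : ℕ} → Protocol α n → Prop
  | _, done _ => True
  | _, ask Q k => (∀ u, Q u ∈ 𝒬) ∧ ∀ u b, (k u b).UsesOnly 𝒬

/-- Post-process the output. -/
def map {α β : Type} (f : α → β) : {n : ℕ} → Protocol α n → Protocol β n
  | _, done a => done (f a)
  | _, ask Q k => ask Q fun u b => (k u b).map f

/-- Run one protocol and then another one, on fresh samples and coins, that may depend on the
output of the first. -/
def bind {α β : Type} {n : ℕ} (f : α → Protocol β n) : {m : ℕ} → Protocol α m → Protocol β (n + m)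
  | _, done a => f a
  | _, ask Q k => ask Q fun u b => (k u b).bind f

/-- Ask the randomized query `Q` in `n` rounds and return the number of positive answers. -/
def count (Q : unitInterval → Set ℝ) : (n : ℕ) → Protocol ℕ n
  | 0 => done 0
  | n + 1 => ask Q fun _ b => (count Q n).map fun s => s + b.toNat

/-- `N 0 + ⋯ + N (k - 1)`. -/
def total (N : ℕ → ℕ) : ℕ → ℕ
  | 0 => 0
  | k + 1 => N k + total N k

/-- Run `p 0, …, p (k - 1)` one after the other, on fresh samples and coins, and return the list of
their outputs as a function on the indices (zero at the indices `≥ k`). -/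
def collect {N : ℕ → ℕ} (p : (i : ℕ) → Protocol ℝ (N i)) :
    (k : ℕ) → Protocol (ℕ → ℝ) (total N k)
  | 0 => done fun _ => 0
  | k + 1 => (collect p k).bind fun v => (p k).map fun y => Function.update v k y

/-- The probability that the output lies in `E`, when the samples are i.i.d. with distribution `D`
and independent of the coins, which are i.i.d. uniform on `[0, 1]`. -/
def prob {α : Type} {n : ℕ} (p : Protocol α n) (D : ProbabilityMeasure ℝ) (E : Set α) : ENNReal :=
  (Measure.pi fun _ : Fin n => (D : Measure ℝ).prod (volume : Measure unitInterval)) (p.run ⁻¹' E)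

end Protocol

/-! ### Distributions -/

/-- The mean of a distribution on the line. -/
def mean (D : ProbabilityMeasure ℝ) : ℝ := ∫ x, x ∂(D : Measure ℝ)

/-- The standard deviation of a distribution on the line. -/
def stdDev (D : ProbabilityMeasure ℝ) : ℝ := √(variance id (D : Measure ℝ))

/-- `M` is a median of `D`. -/
def IsMedian (D : ProbabilityMeasure ℝ) (M : ℝ) : Prop :=
  1 / 2 ≤ (D : Measure ℝ) (Iic M) ∧ 1 / 2 ≤ (D : Measure ℝ) (Ici M)

/-- Distributions with a finite second moment, mean in `[-lam, lam]` and standard deviation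
at most `σ`. -/
def family (lam σ : ℝ) : Set (ProbabilityMeasure ℝ) :=
  {D | MemLp id 2 (D : Measure ℝ) ∧ |mean D| ≤ lam ∧ stdDev D ≤ σ}

/-- Distributions with a finite second moment, mean in `[-lam, lam]` and standard deviation
in `[σmin, σmax]`. -/
def bandFamily (lam σmin σmax : ℝ) : Set (ProbabilityMeasure ℝ) :=
  {D | MemLp id 2 (D : Measure ℝ) ∧ |mean D| ≤ lam ∧ stdDev D ∈ Icc σmin σmax}

/-- A 1-bit mean estimator is `(ε, δ)`-PAC for the family `𝒟`; the accuracy `ε D` may depend on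
the distribution. -/
def IsPAC {n : ℕ} (p : Protocol ℝ n) (𝒟 : Set (ProbabilityMeasure ℝ))
    (ε : ProbabilityMeasure ℝ → ℝ) (δ : ℝ) : Prop :=
  Measurable p.run ∧
    ∀ D ∈ 𝒟, ENNReal.ofReal (1 - δ) ≤ p.prob D {y | |y - mean D| ≤ ε D}

/-- The logarithm in sample-complexity bounds, `max {1, log x}`. -/
def logp (x : ℝ) : ℝ := max 1 (Real.log x)

/-! ### The main estimator -/

/-- A localization subroutine: for each `(lam, σ, δ)`, a protocol that returns the two endpoints
`(L, U)` of an interval. -/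
structure Localizer where
  size : ℝ → ℝ → ℝ → ℕ
  protocol : (lam σ δ : ℝ) → Protocol (ℝ × ℝ) (size lam σ δ)

/-- The subroutine asks only threshold queries "is `X ≤ t`?", at most
`C (log (lam / σ) + log (1 / δ))` of them, and with probability at least `1 - δ` it returns an
interval `[L, U]` that contains the median (every median, if there are several) and for which
`[L - σ, U + σ]` has length at most `6 σ`. -/
def Localizer.IsMedianLocalizer (loc : Localizer) (C : ℝ) : Prop :=
  ∀ lam σ δ : ℝ, 0 < lam → 0 < σ → 0 < δ → δ < 1 →
    (loc.protocol lam σ δ).UsesOnly (range Iic) ∧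
    Measurable (loc.protocol lam σ δ).run ∧
    (loc.size lam σ δ : ℝ) ≤ C * (logp (lam / σ) + logp (1 / δ)) ∧
    ∀ D ∈ family lam σ, ENNReal.ofReal (1 - δ) ≤
      (loc.protocol lam σ δ).prob D
        {I | (∀ M, IsMedian D M → I.1 ≤ M ∧ M ≤ I.2) ∧ (I.2 + σ) - (I.1 - σ) ≤ 6 * σ}

/-- The breakpoints `m₀ = 0`, `mᵢ = 2 ^ i` for `1 ≤ i ≤ 4`, `mᵢ = 2 (mᵢ₋₁ - 3)` for `i ≥ 5`. -/
def bp : ℕ → ℝ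
  | 0 => 0
  | i + 1 => if i + 1 ≤ 4 then 2 ^ (i + 1) else 2 * (bp i - 3)

/-- The left endpoint `aᵢ` of the region `Rᵢ`, `i ≠ 0` (relative to the centre). -/
def lo (σ : ℝ) (i : ℤ) : ℝ :=
  if 0 < i then bp (i.natAbs - 1) * σ else -(bp i.natAbs * σ)

/-- The right endpoint `bᵢ` of the region `Rᵢ`, `i ≠ 0` (relative to the centre). -/
def hi (σ : ℝ) (i : ℤ) : ℝ :=
  if 0 < i then bp i.natAbs * σ else -(bp (i.natAbs - 1) * σ)

/-- The region `Rᵢ = [σ mᵢ₋₁, σ mᵢ)` for `i ≥ 1`, and `Rᵢ = -R₋ᵢ` for `i ≤ -1`. -/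
def region (σ : ℝ) (i : ℤ) : Set ℝ :=
  if 0 < i then Ico (lo σ i) (hi σ i) else Ioc (lo σ i) (hi σ i)

/-- The threshold index: only the regions with `|i| ≤ iMax` are estimated. -/
def iMax (ε σ : ℝ) : ℕ := sInf {i : ℕ | 5 ≤ i ∧ ((2 : ℝ) ^ i)⁻¹ ≤ 5 * ε / (128 * σ)}

/-- The accuracy to which the two probabilities of region `i` are estimated. -/
def epsReg (ε σ : ℝ) (i : ℤ) : ℝ := ε / (4 * iMax ε σ * (|lo σ i| + |hi σ i|))

/-- The error probability allowed for each of the estimated probabilities. -/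
def deltaReg (ε δ σ : ℝ) : ℝ := δ / (8 * iMax ε σ)

/-- The number of samples `nᵢ` for each of the two probabilities of region `i`. -/
def nReg (ε δ σ : ℝ) (i : ℤ) : ℕ :=
  if i.natAbs ≤ 4 then ⌈1 / (2 * epsReg ε σ i ^ 2) * Real.log (2 / deltaReg ε δ σ)⌉₊
  else ⌈(8 / bp i.natAbs ^ 2 * (1 / epsReg ε σ i ^ 2) + 2 / 3 * (1 / epsReg ε σ i)) *
      Real.log (2 / deltaReg ε δ σ)⌉₊

/-- The random threshold `Tᵢ`, uniform between the endpoints of the region. -/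
def thr (σ : ℝ) (i : ℤ) (u : unitInterval) : ℝ := lo σ i + u * (hi σ i - lo σ i)

/-- The randomized interval query "is `X` between `aᵢ` and `Tᵢ`?", inside the region `Rᵢ`
centred at `c`. -/
def queryLo (c σ : ℝ) (i : ℤ) (u : unitInterval) : Set ℝ :=
  {x | x - c ∈ region σ i ∧ x - c ≤ thr σ i u}

/-- The randomized interval query "is `X` between `Tᵢ` and `bᵢ`?", inside the region `Rᵢ`
centred at `c`. -/
def queryHi (c σ : ℝ) (i : ℤ) (u : unitInterval) : Set ℝ :=
  {x | x - c ∈ region σ i ∧ thr σ i u ≤ x - c}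

/-- The estimate `aᵢ p̂_{aᵢ} + bᵢ p̂_{bᵢ}` of the contribution of region `i` to the mean. -/
def regionEstimate (c ε δ σ : ℝ) (i : ℤ) : Protocol ℝ (nReg ε δ σ i + nReg ε δ σ i) :=
  (Protocol.count (queryLo c σ i) (nReg ε δ σ i)).bind fun (ka : ℕ) =>
    (Protocol.count (queryHi c σ i) (nReg ε δ σ i)).map fun (kb : ℕ) =>
      lo σ i * ((ka : ℝ) / nReg ε δ σ i) + hi σ i * ((kb : ℝ) / nReg ε δ σ i)

/-- The number of samples used for the two regions `R_{j+1}` and `R_{-(j+1)}`. -/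
def nPair (ε δ σ : ℝ) (j : ℕ) : ℕ :=
  (nReg ε δ σ (-(j + 1)) + nReg ε δ σ (-(j + 1))) + (nReg ε δ σ (j + 1) + nReg ε δ σ (j + 1))

/-- The estimate of the joint contribution of the regions `R_{j+1}` and `R_{-(j+1)}`. -/
def pairEstimate (c ε δ σ : ℝ) (j : ℕ) : Protocol ℝ (nPair ε δ σ j) :=
  (regionEstimate c ε δ σ (j + 1)).bind fun y =>
    (regionEstimate c ε δ σ (-(j + 1))).map fun z => y + z

/-- The number of samples of the refinement step. -/
def refineSize (ε δ σ : ℝ) : ℕ := Protocol.total (nPair ε δ σ) (iMax ε σ)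

/-- The refinement step, with the regions centred at `c`. -/
def refine (c ε δ σ : ℝ) : Protocol ℝ (refineSize ε δ σ) :=
  (Protocol.collect (pairEstimate c ε δ σ) (iMax ε σ)).map fun v =>
    c + ∑ j ∈ Finset.range (iMax ε σ), v j

/-- The number of samples of the main estimator. -/
def mainSize (loc : Localizer) (ε δ lam σ : ℝ) : ℕ :=
  refineSize ε δ σ + loc.size lam σ (δ / 2)

/-- The main estimator: localize the mean, then refine around the midpoint of the interval found. -/
def mainEstimator (loc : Localizer) (ε δ lam σ : ℝ) : Protocol ℝ (mainSize loc ε δ lam σ) :=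
  (loc.protocol lam σ (δ / 2)).bind fun I => refine ((I.1 + I.2) / 2) ε δ σ

/-! ### Adapting to a partially unknown variance -/

/-- The last index `T` of the dyadic grid. -/
def gridT (σmin σmax : ℝ) : ℕ := ⌈Real.logb 2 (σmax / σmin)⌉₊

/-- The dyadic grid. -/
def gridσ (σmin : ℝ) (i : ℕ) : ℝ := σmin * 2 ^ i

/-- The accuracy `εᵢ` of the `i`-th run. -/
def gridε (r σmin : ℝ) (i : ℕ) : ℝ := r * gridσ σmin i / 5

/-- The confidence interval `[μ̂ᵢ - εᵢ, μ̂ᵢ + εᵢ]`. -/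
def confInt (r σmin : ℝ) (v : ℕ → ℝ) (i : ℕ) : Set ℝ :=
  Icc (v i - gridε r σmin i) (v i + gridε r σmin i)

/-- The index `i` is feasible: its confidence interval meets those of all larger indices. -/
def Feasible (r σmin : ℝ) (T : ℕ) (v : ℕ → ℝ) (i : ℕ) : Prop :=
  i ≤ T ∧ ∀ j, i < j → j ≤ T → (confInt r σmin v i ∩ confInt r σmin v j).Nonempty

/-- The smallest feasible index. -/
def iStar (r σmin : ℝ) (T : ℕ) (v : ℕ → ℝ) : ℕ := sInf {i | Feasible r σmin T v i}

/-- The number of samples of the `i`-th run. -/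
def gridSize (loc : Localizer) (r δ lam σmin σmax : ℝ) (i : ℕ) : ℕ :=
  mainSize loc (gridε r σmin i) (δ / (gridT σmin σmax + 1)) lam (gridσ σmin i)

/-- The `i`-th run of the main estimator. -/
def gridRun (loc : Localizer) (r δ lam σmin σmax : ℝ) (i : ℕ) :
    Protocol ℝ (gridSize loc r δ lam σmin σmax i) :=
  mainEstimator loc (gridε r σmin i) (δ / (gridT σmin σmax + 1)) lam (gridσ σmin i)

/-- The total number of samples of the adaptive estimator: the sum over `i = 0, …, T`. -/
def adaptiveSize (loc : Localizer) (r δ lam σmin σmax : ℝ) : ℕ :=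
  Protocol.total (gridSize loc r δ lam σmin σmax) (gridT σmin σmax + 1)

/-- The adaptive estimator: run the main estimator for `i = 0, …, T` and return the estimate with
the smallest feasible index. -/
def adaptiveEstimator (loc : Localizer) (r δ lam σmin σmax : ℝ) :
    Protocol ℝ (adaptiveSize loc r δ lam σmin σmax) :=
  (Protocol.collect (gridRun loc r δ lam σmin σmax) (gridT σmin σmax + 1)).map fun v =>
    v (iStar r σmin (gridT σmin σmax) v)

end OneBit

end

/-!
The proof has four ingredients.

*Localization.* The line is cut into cells of length `σ / 2`, and `searchLocalizer` looks for a cell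
whose right boundary carries probability more than `1 / 6` on its left and whose left boundary
carries less than `1 / 2` (`IsHit`). Such a cell lies to the left of all medians, and within `3 σ`
of the mean by Chebyshev's inequality, so the interval of length `4 σ` to its right contains the
medians. The search is a multiplicative-weights noisy binary search: each round tests both
boundaries of the weighted median cell and penalizes the cells that contradict the answers.
Between the levels `1 / 6` and `1 / 2` the answers may be pure noise, so no single cell can be
expected to win; instead one compares the total weight with that of the cell where the
probability crosses `1 / 3`. In the mean this ratio grows by a factor close to one in any round
and drops by a definite factor in a round that visits a cell which is not a hit
(`visitValue_mul_mean_le`). As the ratio is at least one, most visited cells are hits, except with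
a probability exponentially small in the number of rounds (`pr_search_le`). The two conditions
that define a hit are monotone in the cell, so the median of the visited cells is then a hit.

*Refinement.* A threshold uniform between the endpoints of a region rounds a point of the region to
an endpoint without bias (`lo_mul_queryProb_add`), so the region estimates are unbiased for the
truncated mean. Hoeffding's inequality for the near regions, and Bernstein's inequality with the
Chebyshev bound on the probability of the far regions, control the errors; the part beyond the
last region contributes at most `ε / 2` (`truncation_bias_le_half`).

*Adaptation.* All runs whose `σᵢ` is at least the true standard deviation are accurate at the same
time with probability `1 - δ`. Then the first of them is feasible, and the smallest feasible index
gives an estimate consistent with it (`abs_apply_iStar_sub_le`).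

*Sample sizes.* `iMax` depends on `r` only and is `O(log (1 / r))`. The weights `ε / (|aᵢ| + |bᵢ|)`
of the far regions are compensated by their small variance, so that each region costs
`O(iMax² / r² · log (1 / δ'))` samples (`nReg_le`).

Probabilities of outputs are handled through the recursive functional `Protocol.expect`, which
commutes with `bind`, `map` and `collect` without measurability assumptions; joint measurability
of the protocols in parameters and samples serves to identify it with `Protocol.prob`.
-/

noncomputable section

namespace OneBit

/-! ### Round-by-round probabilities of protocols -/

namespace Protocol

variable {α β Θ : Type}

open Classical in
/-- The expected value of `f` at the output, computed round by round. Unlike `Protocol.prob`, this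
iterated lower integral is compatible with `bind`, `map` and `collect` without any measurability
assumption; the two agree by `prob_eq_pr` once `Protocol.run` is measurable. -/
def expect (D : ProbabilityMeasure ℝ) (f : α → ENNReal) : {n : ℕ} → Protocol α n → ENNReal
  | _, done a => f a
  | _, ask Q k => ∫⁻ z : ℝ × unitInterval, expect D f (k z.2 (decide (z.1 ∈ Q z.2)))
      ∂((D : Measure ℝ).prod (volume : Measure unitInterval))

/-- The probability that the output lies in `E`, computed round by round. -/
def pr (D : ProbabilityMeasure ℝ) {n : ℕ} (p : Protocol α n) (E : Set α) : ENNReal :=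
  expect D (E.indicator 1) p

variable (D : ProbabilityMeasure ℝ)

theorem expect_mono {f g : α → ENNReal} (h : ∀ a, f a ≤ g a) {n : ℕ} (p : Protocol α n) :
    expect D f p ≤ expect D g p := by
  induction p with
  | done a => exact h a
  | ask Q k ih => exact lintegral_mono fun z => ih _ _

theorem expect_const (c : ENNReal) {n : ℕ} (p : Protocol α n) :
    expect D (fun _ => c) p = c := by
  induction p with
  | done a => rfl
  | ask Q k ih => simp [expect, ih]

theorem expect_add_const (f : α → ENNReal) (c : ENNReal) {n : ℕ} (p : Protocol α n) :
    expect D (fun a => f a + c) p = expect D f p + c := by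
  induction p with
  | done a => rfl
  | ask Q k ih => simp only [expect, ih]; rw [lintegral_add_right _ measurable_const]; simp

theorem expect_const_mul (f : α → ENNReal) {c : ENNReal} (hc : c ≠ ⊤) {n : ℕ}
    (p : Protocol α n) : expect D (fun a => c * f a) p = c * expect D f p := by
  induction p with
  | done a => rfl
  | ask Q k ih => simp only [expect, ih]; rw [lintegral_const_mul' _ _ hc]

theorem expect_map (g : α → β) (f : β → ENNReal) {n : ℕ} (p : Protocol α n) :
    expect D f (p.map g) = expect D (fun a => f (g a)) p := by
  induction p with
  | done a => rfl
  | ask Q k ih => simp only [expect, map, ih]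

theorem expect_bind {n m : ℕ} (g : α → Protocol β n) (f : β → ENNReal) (p : Protocol α m) :
    expect D f (p.bind g) = expect D (fun a => expect D f (g a)) p := by
  induction p with
  | done a => rfl
  | ask Q k ih => simp only [expect, bind, ih]

theorem run_map (g : α → β) {n : ℕ} (p : Protocol α n) (ω : Fin n → ℝ × unitInterval) :
    (p.map g).run ω = g (p.run ω) := by
  induction p with
  | done a => rfl
  | ask Q k ih => simp only [run, map, ih]

theorem run_bind {n m : ℕ} (g : α → Protocol β n) (p : Protocol α m)
    (ω : Fin (n + m) → ℝ × unitInterval) :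
    (p.bind g).run ω =
      (g (p.run fun i => ω (Fin.castLE (Nat.le_add_left m n) i))).run
        fun i => ω ⟨m + i, by omega⟩ := by
  induction p with
  | done a => simp [run, bind]
  | @ask m Q k ih =>
    simp only [bind]
    rw [run, ih]
    congr 1
    funext i
    simp only [Fin.tail]
    congr 1
    ext
    simp
    omega

/-- Fubini's theorem, applied once per round. -/
theorem expect_eq_lintegral (f : α → ENNReal) {n : ℕ} (p : Protocol α n)
    (hp : Measurable fun ω => f (p.run ω)) :
    expect D f p = ∫⁻ ω, f (p.run ω)
      ∂(Measure.pi fun _ : Fin n => (D : Measure ℝ).prod (volume : Measure unitInterval)) := by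
  induction p with
  | done a => simp [expect, run]
  | @ask m Q k ih =>
    have hmp := (measurePreserving_piFinSuccAbove
      (fun _ : Fin (m + 1) => (D : Measure ℝ).prod (volume : Measure unitInterval)) 0).symm
    rw [← hmp.lintegral_comp hp, lintegral_prod]
    · simp only [expect]
      refine lintegral_congr fun z => ?_
      have key : ∀ ω : Fin m → ℝ × unitInterval,
          (ask Q k).run ((MeasurableEquiv.piFinSuccAbove
            (fun _ : Fin (m + 1) => ℝ × unitInterval) 0).symm (z, ω)) =
          (k z.2 (open Classical in decide (z.1 ∈ Q z.2))).run ω := by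
        intro ω
        have e : (MeasurableEquiv.piFinSuccAbove
            (fun _ : Fin (m + 1) => ℝ × unitInterval) 0).symm (z, ω) =
            Fin.cons (α := fun _ => ℝ × unitInterval) z ω :=
          Fin.insertNth_zero (α := fun _ => ℝ × unitInterval) z ω
        rw [e]
        rfl
      rw [ih]
      · refine lintegral_congr fun ω => ?_
        rw [key]
      · have : Measurable fun ω : Fin m → ℝ × unitInterval =>
            f ((ask Q k).run ((MeasurableEquiv.piFinSuccAbove
              (fun _ : Fin (m + 1) => ℝ × unitInterval) 0).symm (z, ω))) :=
          hp.comp ((MeasurableEquiv.measurable _).comp measurable_prodMk_left)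
        simpa only [key] using this
    · exact (hp.comp (MeasurableEquiv.measurable _)).aemeasurable

theorem prob_eq_pr [MeasurableSpace α] {n : ℕ} {p : Protocol α n} (hp : Measurable p.run)
    {E : Set α} (hE : MeasurableSet E) : p.prob D E = pr D p E := by
  have hm : Measurable fun ω => E.indicator (1 : α → ENNReal) (p.run ω) :=
    (measurable_one.indicator hE).comp hp
  rw [pr, expect_eq_lintegral D _ p hm, prob, ← lintegral_indicator_one (hp hE)]
  rfl

theorem pr_mono {A B : Set α} (h : A ⊆ B) {n : ℕ} (p : Protocol α n) : pr D p A ≤ pr D p B :=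
  expect_mono D (fun a => indicator_le_indicator_of_subset h (fun _ => zero_le) a) p

theorem pr_le_one (A : Set α) {n : ℕ} (p : Protocol α n) : pr D p A ≤ 1 := by
  refine (expect_mono D (g := fun _ => 1) (fun a => ?_) p).trans (expect_const D 1 p).le
  exact indicator_le_self' (fun _ _ => zero_le) a

theorem pr_map (g : α → β) (B : Set β) {n : ℕ} (p : Protocol α n) :
    pr D (p.map g) B = pr D p (g ⁻¹' B) := by
  rw [pr, expect_map]; rfl

/-- If the first stage avoids `A`, the second stage fails with probability at most `c`. -/
theorem pr_bind_le {n m : ℕ} (g : α → Protocol β n) (p : Protocol α m) {A : Set α} {B : Set β}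
    {c : ENNReal} (h : ∀ a ∉ A, pr D (g a) B ≤ c) :
    pr D (p.bind g) B ≤ pr D p A + c := by
  rw [pr, expect_bind, pr, ← expect_add_const]
  refine expect_mono D (fun a => ?_) p
  by_cases ha : a ∈ A
  · rw [indicator_of_mem ha]
    exact (pr_le_one D B (g a)).trans (le_add_right le_rfl)
  · rw [indicator_of_notMem ha, zero_add]
    exact h a ha

/-- The lower integral that defines `pr` is only superadditive, so the union bound does need
measurability. -/
theorem pr_union_le [MeasurableSpace α] {n : ℕ} {p : Protocol α n} (hp : Measurable p.run)
    {A B : Set α} (hA : MeasurableSet A) (hB : MeasurableSet B) :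
    pr D p (A ∪ B) ≤ pr D p A + pr D p B := by
  rw [← prob_eq_pr D hp hA, ← prob_eq_pr D hp hB, ← prob_eq_pr D hp (hA.union hB)]
  exact measure_union_le _ _

theorem prob_ge_of_pr_compl_le [MeasurableSpace α] {n : ℕ} {p : Protocol α n}
    (hp : Measurable p.run) {E : Set α} (hE : MeasurableSet E) {δ : ℝ} (hδ : 0 ≤ δ)
    (h : pr D p Eᶜ ≤ ENNReal.ofReal δ) : ENNReal.ofReal (1 - δ) ≤ p.prob D E := by
  rw [← prob_eq_pr D hp hE.compl] at h
  have h1 : p.prob D E = 1 - p.prob D Eᶜ := by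
    rw [prob, prob, preimage_compl, prob_compl_eq_one_sub (hp hE)]
    exact (ENNReal.sub_sub_cancel ENNReal.one_ne_top prob_le_one).symm
  rw [h1, ENNReal.ofReal_sub _ hδ, ENNReal.ofReal_one]
  exact tsub_le_tsub_left h 1

theorem pr_compl_le_of_prob_ge [MeasurableSpace α] {n : ℕ} {p : Protocol α n}
    (hp : Measurable p.run) {E : Set α} (hE : MeasurableSet E) {δ : ℝ}
    (hδ1 : δ ≤ 1) (h : ENNReal.ofReal (1 - δ) ≤ p.prob D E) :
    pr D p Eᶜ ≤ ENNReal.ofReal δ := by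
  rw [← prob_eq_pr D hp hE.compl, prob, preimage_compl, prob_compl_eq_one_sub (hp hE)]
  refine (tsub_le_tsub_left h 1).trans ?_
  rw [← ENNReal.ofReal_one, ← ENNReal.ofReal_sub _ (by linarith)]
  simp

/-- Union bound for independent runs of several protocols. The events are treated one run at a
time, which avoids the measurability assumption of `pr_union_le`. -/
theorem pr_collect_le {N : ℕ → ℕ} (p : (i : ℕ) → Protocol ℝ (N i)) (B : ℕ → Set ℝ) (k : ℕ) :
    pr D (collect p k) {v | ∃ i < k, v i ∈ B i} ≤ ∑ i ∈ Finset.range k, pr D (p i) (B i) := by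
  induction k with
  | zero => simp [collect, pr, expect]
  | succ k ih =>
    rw [Finset.sum_range_succ]
    refine (pr_bind_le D _ _ (A := {v | ∃ i < k, v i ∈ B i}) (c := pr D (p k) (B k)) ?_).trans
      (add_le_add ih le_rfl)
    intro v hv
    rw [pr_map]
    refine pr_mono D (fun y hy => ?_) _
    obtain ⟨i, hi, hiB⟩ := hy
    dsimp only at hiB
    rcases Nat.lt_succ_iff_lt_or_eq.1 hi with h | rfl
    · rw [Function.update_of_ne h.ne] at hiB
      exact absurd ⟨i, h, hiB⟩ hv
    · simpa using hiB

/-! ### Measurability of protocols -/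

variable [MeasurableSpace α] [MeasurableSpace β] [MeasurableSpace Θ]

/-- A family of protocols whose output is jointly measurable in the parameter and the samples. -/
def JointlyMeasurable {n : ℕ} (p : Θ → Protocol α n) : Prop :=
  Measurable fun x : Θ × (Fin n → ℝ × unitInterval) => (p x.1).run x.2

theorem JointlyMeasurable.measurable_run {n : ℕ} {p : Θ → Protocol α n}
    (hp : JointlyMeasurable p) (θ : Θ) : Measurable (p θ).run :=
  Measurable.comp (g := fun x : Θ × (Fin n → ℝ × unitInterval) => (p x.1).run x.2) hp
    measurable_prodMk_left

theorem jointlyMeasurable_const {n : ℕ} {p : Protocol α n} (hp : Measurable p.run) :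
    JointlyMeasurable fun _ : Θ => p :=
  hp.comp measurable_snd

theorem JointlyMeasurable.comp {Θ' : Type} [MeasurableSpace Θ'] {n : ℕ} {p : Θ → Protocol α n}
    (hp : JointlyMeasurable p) {g : Θ' → Θ} (hg : Measurable g) :
    JointlyMeasurable fun θ => p (g θ) :=
  Measurable.comp hp ((hg.comp measurable_fst).prodMk measurable_snd)

theorem JointlyMeasurable.bind {n m : ℕ} {p : Θ → Protocol α m} {f : Θ → α → Protocol β n}
    (hp : JointlyMeasurable p) (hf : JointlyMeasurable fun x : Θ × α => f x.1 x.2) :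
    JointlyMeasurable fun θ => (p θ).bind (f θ) := by
  unfold JointlyMeasurable
  simp only [run_bind]
  have h1 : Measurable fun x : Θ × (Fin (n + m) → ℝ × unitInterval) =>
      (p x.1).run fun i => x.2 (Fin.castLE (Nat.le_add_left m n) i) :=
    Measurable.comp (g := fun y : Θ × (Fin m → ℝ × unitInterval) => (p y.1).run y.2) hp
      (f := fun x : Θ × (Fin (n + m) → ℝ × unitInterval) =>
        (x.1, fun i => x.2 (Fin.castLE (Nat.le_add_left m n) i))) (by fun_prop)
  exact Measurable.comp
    (g := fun y : (Θ × α) × (Fin n → ℝ × unitInterval) => (f y.1.1 y.1.2).run y.2) hf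
    ((measurable_fst.prodMk h1).prodMk
      (measurable_pi_lambda _ fun i => (measurable_pi_apply _).comp measurable_snd))

theorem JointlyMeasurable.map {n : ℕ} {p : Θ → Protocol α n} {f : Θ → α → β}
    (hp : JointlyMeasurable p) (hf : Measurable fun x : Θ × α => f x.1 x.2) :
    JointlyMeasurable fun θ => (p θ).map (f θ) := by
  unfold JointlyMeasurable
  simp only [run_map]
  exact hf.comp (measurable_fst.prodMk hp)

theorem JointlyMeasurable.collect {N : ℕ → ℕ} {p : (i : ℕ) → Θ → Protocol ℝ (N i)} (k : ℕ)
    (hp : ∀ i < k, JointlyMeasurable (p i)) :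
    JointlyMeasurable fun θ => Protocol.collect (fun i => p i θ) k := by
  induction k with
  | zero => exact measurable_const
  | succ k ih =>
    refine JointlyMeasurable.bind (ih fun i hi => hp i (by omega)) ?_
    refine JointlyMeasurable.map ((hp k (by omega)).comp measurable_fst) ?_
    refine measurable_pi_lambda _ fun i => ?_
    by_cases h : i = k
    · subst h
      simpa using measurable_snd
    · simp only [Function.update_of_ne h]
      fun_prop

theorem JointlyMeasurable.count {Q : Θ → unitInterval → Set ℝ}
    (hQ : MeasurableSet {x : Θ × ℝ × unitInterval | x.2.1 ∈ Q x.1 x.2.2}) (n : ℕ) :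
    JointlyMeasurable fun θ => Protocol.count (Q θ) n := by
  induction n with
  | zero => exact measurable_const
  | succ n ih =>
    classical
    unfold JointlyMeasurable
    simp only [Protocol.count, run, run_map]
    refine Measurable.add ?_ ?_
    · exact Measurable.comp (g := fun y : Θ × (Fin n → ℝ × unitInterval) =>
        (Protocol.count (Q y.1) n).run y.2) ih
        (measurable_fst.prodMk (measurable_pi_lambda _ fun i =>
          (measurable_pi_apply _).comp measurable_snd))
    · have : Measurable fun x : Θ × (Fin (n + 1) → ℝ × unitInterval) =>
          if (x.2 0).1 ∈ Q x.1 (x.2 0).2 then (1 : ℕ) else 0 := by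
        refine Measurable.ite ?_ measurable_const measurable_const
        exact hQ.preimage (f := fun x : Θ × (Fin (n + 1) → ℝ × unitInterval) => (x.1, x.2 0))
          (by fun_prop)
      convert this using 2 with x
      by_cases h : (x.2 0).1 ∈ Q x.1 (x.2 0).2 <;> simp [h]

end Protocol

/-! ### Concentration of the number of positive answers -/

section Concentration

theorem two_mul_three_pow_le_factorial (k : ℕ) : 2 * 3 ^ k ≤ (k + 2).factorial := by
  induction k with
  | zero => simp
  | succ k ih =>
    rw [show k + 1 + 2 = (k + 2) + 1 by ring, Nat.factorial_succ, pow_succ]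
    nlinarith

/-- Bernstein's estimate of the exponential remainder, by comparison with a geometric series. -/
theorem exp_sub_one_sub_le {t : ℝ} (ht : 0 ≤ t) (ht3 : t < 3) :
    Real.exp t - 1 - t ≤ t ^ 2 / (2 * (1 - t / 3)) := by
  have h1 : HasSum (fun k : ℕ => t ^ k / k.factorial) (Real.exp t) := by
    rw [Real.exp_eq_exp_ℝ]
    exact NormedSpace.expSeries_div_hasSum_exp t
  have h2 : HasSum (fun k : ℕ => t ^ (k + 2) / (k + 2).factorial) (Real.exp t - 1 - t) := by
    have := (hasSum_nat_add_iff' 2).2 h1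
    simpa [Finset.sum_range_succ, sub_sub] using this
  have h3 : HasSum (fun k : ℕ => t ^ 2 / 2 * (t / 3) ^ k) (t ^ 2 / 2 * (1 - t / 3)⁻¹) :=
    (hasSum_geometric_of_lt_one (by positivity) (by linarith)).mul_left _
  have h4 := hasSum_le (fun k => ?_) h2 h3
  · refine h4.trans (le_of_eq ?_)
    rw [div_mul_eq_mul_div, ← div_eq_mul_inv, div_div, mul_comm (1 - t / 3)]
  · rw [div_pow, div_mul_div_comm, pow_add, mul_comm (t ^ 2)]
    gcongr
    exact_mod_cast two_mul_three_pow_le_factorial k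

theorem exp_neg_le_quadratic {t : ℝ} (ht : 0 ≤ t) : Real.exp (-t) ≤ 1 - t + t ^ 2 / 2 := by
  have h := Real.quadratic_le_exp_of_nonneg ht
  rw [Real.exp_neg, inv_le_iff_one_le_mul₀ (Real.exp_pos t)]
  nlinarith [sq_nonneg (t - 1), sq_nonneg (t ^ 2),
    mul_le_mul_of_nonneg_left h (by nlinarith [sq_nonneg (t - 1)] : 0 ≤ 1 - t + t ^ 2 / 2)]

/-- The joint distribution of the sample and the private coin of one round. -/
def law (D : ProbabilityMeasure ℝ) : Measure (ℝ × unitInterval) :=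
  (D : Measure ℝ).prod (volume : Measure unitInterval)

instance (D : ProbabilityMeasure ℝ) : IsProbabilityMeasure (law D) := by
  unfold law; infer_instance

/-- The event that the answer to the randomized query `Q` is positive. -/
def answerSet (Q : unitInterval → Set ℝ) : Set (ℝ × unitInterval) := {z | z.1 ∈ Q z.2}

/-- The probability of a positive answer to the randomized query `Q`. -/
def queryProb (D : ProbabilityMeasure ℝ) (Q : unitInterval → Set ℝ) : ℝ :=
  (law D).real (answerSet Q)

variable (D : ProbabilityMeasure ℝ) {Q : unitInterval → Set ℝ}

theorem queryProb_nonneg : 0 ≤ queryProb D Q := measureReal_nonneg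

theorem queryProb_le_one : queryProb D Q ≤ 1 := measureReal_le_one

theorem lintegral_exp_answer (hQ : MeasurableSet (answerSet Q)) (t : ℝ) :
    ∫⁻ z, ENNReal.ofReal (Real.exp (t * (open Classical in decide (z.1 ∈ Q z.2)).toNat)) ∂(law D) =
      ENNReal.ofReal (1 + queryProb D Q * (Real.exp t - 1)) := by
  have h : ∀ z : ℝ × unitInterval,
      ENNReal.ofReal (Real.exp (t * (open Classical in decide (z.1 ∈ Q z.2)).toNat)) =
      (answerSet Q).indicator (fun _ => ENNReal.ofReal (Real.exp t)) z +
        (answerSet Q)ᶜ.indicator (fun _ => 1) z := by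
    intro z
    by_cases hz : z.1 ∈ Q z.2
    · have : z ∈ answerSet Q := hz
      simp [hz, this]
    · have : z ∉ answerSet Q := hz
      simp [hz, this]
  simp only [h]
  rw [lintegral_add_left (measurable_const.indicator hQ), lintegral_indicator_const hQ,
    lintegral_indicator_const hQ.compl, prob_compl_eq_one_sub hQ, one_mul]
  have hp : law D (answerSet Q) = ENNReal.ofReal (queryProb D Q) :=
    (ofReal_measureReal).symm
  rw [hp, ← ENNReal.ofReal_one, ← ENNReal.ofReal_sub _ (queryProb_nonneg D),
    ← ENNReal.ofReal_mul (Real.exp_pos t).le, ← ENNReal.ofReal_add]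
  · congr 1; ring
  · exact mul_nonneg (Real.exp_pos t).le (queryProb_nonneg D)
  · linarith [queryProb_le_one D (Q := Q)]

theorem expect_count_exp (hQ : MeasurableSet (answerSet Q)) (t : ℝ) (n : ℕ) :
    Protocol.expect D (fun s : ℕ => ENNReal.ofReal (Real.exp (t * s))) (Protocol.count Q n) =
      ENNReal.ofReal (1 + queryProb D Q * (Real.exp t - 1)) ^ n := by
  induction n with
  | zero => simp [Protocol.count, Protocol.expect]
  | succ n ih =>
    simp only [Protocol.count, Protocol.expect, Protocol.expect_map]
    have h : ∀ b : Bool, Protocol.expect D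
        (fun a : ℕ => ENNReal.ofReal (Real.exp (t * ((a + b.toNat : ℕ) : ℝ))))
          (Protocol.count Q n) =
        ENNReal.ofReal (Real.exp (t * b.toNat)) *
          ENNReal.ofReal (1 + queryProb D Q * (Real.exp t - 1)) ^ n := by
      intro b
      rw [← ih, ← Protocol.expect_const_mul D _ ENNReal.ofReal_ne_top]
      congr 1
      funext a
      rw [← ENNReal.ofReal_mul (Real.exp_pos _).le, ← Real.exp_add]
      push_cast
      ring_nf
    simp only [h]
    rw [lintegral_mul_const' _ _ (ENNReal.pow_ne_top ENNReal.ofReal_ne_top), pow_succ']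
    congr 1
    exact lintegral_exp_answer D hQ t

/-- Chernoff's bound; both tails are covered, as `t` may be negative. -/
theorem pr_count_le (hQ : MeasurableSet (answerSet Q)) {t ψ : ℝ} (a : ℝ)
    (h : 1 + queryProb D Q * (Real.exp t - 1) ≤ Real.exp ψ) (n : ℕ) :
    Protocol.pr D (Protocol.count Q n) {s | a ≤ t * s} ≤
      ENNReal.ofReal (Real.exp (n * ψ - a)) := by
  calc Protocol.pr D (Protocol.count Q n) {s | a ≤ t * s}
      ≤ Protocol.expect D (fun s : ℕ => ENNReal.ofReal (Real.exp (-a)) *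
          ENNReal.ofReal (Real.exp (t * s))) (Protocol.count Q n) := by
        refine Protocol.expect_mono D (fun s => ?_) _
        by_cases hs : a ≤ t * s
        · have hs' : s ∈ {s : ℕ | a ≤ t * s} := hs
          rw [indicator_of_mem hs', ← ENNReal.ofReal_mul (Real.exp_pos _).le, ← Real.exp_add]
          simpa using hs
        · have hs' : s ∉ {s : ℕ | a ≤ t * s} := hs
          rw [indicator_of_notMem hs']
          exact zero_le
    _ = ENNReal.ofReal (Real.exp (-a)) *
          ENNReal.ofReal (1 + queryProb D Q * (Real.exp t - 1)) ^ n := by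
        rw [Protocol.expect_const_mul D _ ENNReal.ofReal_ne_top, expect_count_exp D hQ]
    _ ≤ ENNReal.ofReal (Real.exp (-a)) * ENNReal.ofReal (Real.exp ψ) ^ n := by gcongr
    _ = ENNReal.ofReal (Real.exp (n * ψ - a)) := by
        rw [← ENNReal.ofReal_pow (Real.exp_pos _).le, ← ENNReal.ofReal_mul (Real.exp_pos _).le,
          ← Real.exp_nat_mul, ← Real.exp_add]
        ring_nf

theorem measurable_run_count (hQ : MeasurableSet (answerSet Q)) (n : ℕ) :
    Measurable (Protocol.count Q n).run :=
  (Protocol.JointlyMeasurable.count (Θ := Unit) (Q := fun _ => Q)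
    (hQ.preimage (f := fun x : Unit × ℝ × unitInterval => x.2) measurable_snd) n).measurable_run ()

theorem pr_count_deviation_le (hQ : MeasurableSet (answerSet Q)) {t v ε : ℝ} (ht : 0 < t)
    (h1 : 1 + queryProb D Q * (Real.exp t - 1) ≤ Real.exp (t * queryProb D Q + v))
    (h2 : 1 + queryProb D Q * (Real.exp (-t) - 1) ≤ Real.exp (-t * queryProb D Q + v))
    {n : ℕ} (hn : 0 < n) :
    Protocol.pr D (Protocol.count Q n) {s | ε < |(s : ℝ) / n - queryProb D Q|} ≤
      ENNReal.ofReal (2 * Real.exp (n * (v - t * ε))) := by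
  have hn' : (0 : ℝ) < n := by exact_mod_cast hn
  set p := queryProb D Q
  have hsub : {s : ℕ | ε < |(s : ℝ) / n - p|} ⊆
      {s : ℕ | n * (t * p + t * ε) ≤ t * s} ∪ {s : ℕ | n * (-t * p + t * ε) ≤ -t * s} := by
    intro s hs
    rcases lt_abs.1 (mem_ofPred_eq ▸ hs) with h | h
    · left
      have : p + ε < s / n := by linarith
      rw [lt_div_iff₀ hn'] at this
      simp only [mem_ofPred_eq]
      nlinarith
    · right
      have : (s : ℝ) / n < p - ε := by linarith
      rw [div_lt_iff₀ hn'] at this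
      simp only [mem_ofPred_eq]
      nlinarith
  refine (Protocol.pr_mono D hsub _).trans ((Protocol.pr_union_le D (measurable_run_count hQ n)
    (MeasurableSet.of_discrete) (MeasurableSet.of_discrete)).trans ?_)
  refine (add_le_add (pr_count_le D hQ _ h1 n) (pr_count_le D hQ _ h2 n)).trans (le_of_eq ?_)
  rw [← ENNReal.ofReal_add (Real.exp_pos _).le (Real.exp_pos _).le]
  congr 1
  rw [two_mul]
  congr 2 <;> ring

/-- Hoeffding's lemma for a Bernoulli variable. -/
theorem bernoulli_mgf_le_hoeffding (hQ : MeasurableSet (answerSet Q)) (t : ℝ) :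
    1 + queryProb D Q * (Real.exp t - 1) ≤ Real.exp (t * queryProb D Q + t ^ 2 / 8) := by
  set X : ℝ × unitInterval → ℝ := (answerSet Q).indicator 1 with hX
  have hXm : Measurable X := measurable_one.indicator hQ
  have hI : ∫ z, X z ∂(law D) = queryProb D Q := by
    rw [hX, integral_indicator_one hQ]; rfl
  have hs := hasSubgaussianMGF_of_mem_Icc (μ := law D) (a := 0) (b := 1) hXm.aemeasurable
    (Filter.Eventually.of_forall fun z => by
      by_cases h : z ∈ answerSet Q <;> simp [hX, h])
  have h := hs.mgf_le t
  have hm : mgf (fun z => X z - ∫ z, X z ∂(law D)) (law D) t =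
      Real.exp (-(t * queryProb D Q)) * (1 + queryProb D Q * (Real.exp t - 1)) := by
    rw [hI, mgf]
    have : ∀ z, Real.exp (t * (X z - queryProb D Q)) =
        Real.exp (-(t * queryProb D Q)) +
          (answerSet Q).indicator 1 z *
            (Real.exp (-(t * queryProb D Q)) * (Real.exp t - 1)) := by
      intro z
      by_cases h : z ∈ answerSet Q
      · simp only [hX, indicator_of_mem h, Pi.one_apply]
        rw [show t * (1 - queryProb D Q) = -(t * queryProb D Q) + t by ring, Real.exp_add]
        ring
      · simp only [hX, indicator_of_notMem h]
        rw [show t * (0 - queryProb D Q) = -(t * queryProb D Q) by ring]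
        ring
    simp only [this]
    rw [integral_add (integrable_const _), integral_mul_const, integral_indicator_one hQ]
    · simp only [integral_const, probReal_univ, smul_eq_mul]
      rw [show (law D).real (answerSet Q) = queryProb D Q from rfl]
      ring
    · exact (((integrable_const 1).indicator hQ).congr
        (Filter.Eventually.of_forall fun z => rfl)).mul_const _
  rw [hm, Real.exp_neg, inv_mul_le_iff₀ (Real.exp_pos _), ← Real.exp_add] at h
  refine h.trans (le_of_eq ?_)
  congr 2
  norm_num
  ring

/-- Hoeffding's inequality, in the form of a sample size. -/
theorem pr_count_hoeffding (hQ : MeasurableSet (answerSet Q)) {ε δ : ℝ} (hε : 0 < ε) (hδ : 0 < δ)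
    {n : ℕ} (hn : 0 < n) (h : 1 / (2 * ε ^ 2) * Real.log (2 / δ) ≤ n) :
    Protocol.pr D (Protocol.count Q n) {s | ε < |(s : ℝ) / n - queryProb D Q|} ≤
      ENNReal.ofReal δ := by
  refine (pr_count_deviation_le D hQ (t := 4 * ε) (v := (4 * ε) ^ 2 / 8) (by positivity)
    (bernoulli_mgf_le_hoeffding D hQ _) ?_ hn).trans (ENNReal.ofReal_le_ofReal ?_)
  · simpa using bernoulli_mgf_le_hoeffding D hQ (-(4 * ε))
  · have h1 : n * ((4 * ε) ^ 2 / 8 - 4 * ε * ε) ≤ -Real.log (2 / δ) := by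
      rw [div_mul_eq_mul_div, one_mul, div_le_iff₀ (by positivity)] at h
      nlinarith
    calc 2 * Real.exp (n * ((4 * ε) ^ 2 / 8 - 4 * ε * ε))
        ≤ 2 * Real.exp (-Real.log (2 / δ)) := by gcongr
      _ = δ := by
        rw [Real.exp_neg, Real.exp_log (by positivity)]
        field_simp

/-- Bernstein's inequality, in the form of a sample size; `V` bounds the probability of a positive
answer, and hence the variance of the answer. -/
theorem pr_count_bernstein (hQ : MeasurableSet (answerSet Q)) {ε δ V : ℝ} (hε : 0 < ε)
    (hδ : 0 < δ) (hV : 0 < V) (hQV : queryProb D Q ≤ V) {n : ℕ} (hn : 0 < n)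
    (h : (2 * V / ε ^ 2 + 2 / 3 * (1 / ε)) * Real.log (2 / δ) ≤ n) :
    Protocol.pr D (Protocol.count Q n) {s | ε < |(s : ℝ) / n - queryProb D Q|} ≤
      ENNReal.ofReal δ := by
  -- For this `t` the exponent `V * t ^ 2 / (2 * (1 - t / 3)) - t * ε` collapses to `-t * ε / 2`.
  set t := ε / (V + ε / 3) with ht
  have hd : 0 < V + ε / 3 := by positivity
  have ht0 : 0 < t := by positivity
  have h1t : 1 - t / 3 = V / (V + ε / 3) := by rw [ht]; field_simp; ring
  have ht3 : t < 3 := by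
    have : 0 < 1 - t / 3 := by rw [h1t]; positivity
    linarith
  set v := V * (t ^ 2 / (2 * (1 - t / 3))) with hv
  have hp0 := queryProb_nonneg D (Q := Q)
  have hvt : v = t * ε / 2 := by
    rw [hv, h1t, ht]; field_simp
  refine (pr_count_deviation_le D hQ (t := t) (v := v) ht0 ?_ ?_ hn).trans
    (ENNReal.ofReal_le_ofReal ?_)
  · have h2 := exp_sub_one_sub_le ht0.le ht3
    have h3 : queryProb D Q * (Real.exp t - 1 - t) ≤ v :=
      mul_le_mul hQV h2 (by linarith [Real.add_one_le_exp t]) hV.le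
    have h4 := Real.add_one_le_exp (t * queryProb D Q + v)
    nlinarith
  · have h2 := exp_neg_le_quadratic ht0.le
    have h5 : t ^ 2 / 2 ≤ t ^ 2 / (2 * (1 - t / 3)) := by
      have : 0 < 1 - t / 3 := by rw [h1t]; positivity
      gcongr
      linarith
    have h3 : queryProb D Q * (Real.exp (-t) - 1 + t) ≤ v :=
      mul_le_mul hQV (by linarith) (by linarith [Real.add_one_le_exp (-t)]) hV.le
    have h4 := Real.add_one_le_exp (-t * queryProb D Q + v)
    nlinarith
  · have h1 : n * (v - t * ε) ≤ -Real.log (2 / δ) := by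
      have e : (2 * V / ε ^ 2 + 2 / 3 * (1 / ε)) = 2 / (t * ε) := by
        rw [ht]; field_simp
      rw [e, div_mul_eq_mul_div, div_le_iff₀ (by positivity)] at h
      rw [hvt]
      nlinarith
    calc 2 * Real.exp (n * (v - t * ε))
        ≤ 2 * Real.exp (-Real.log (2 / δ)) := by gcongr
      _ = δ := by
        rw [Real.exp_neg, Real.exp_log (by positivity)]
        field_simp

end Concentration

/-! ### Medians and tail bounds -/

section Tails

variable {D : ProbabilityMeasure ℝ} {lam σ : ℝ}

theorem integrable_id_of_family (hD : D ∈ family lam σ) :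
    Integrable (fun x : ℝ => x) (D : Measure ℝ) :=
  hD.1.integrable (by norm_num)

theorem integrable_centered_sq (hD : D ∈ family lam σ) (a : ℝ) :
    Integrable (fun x : ℝ => (x - a) ^ 2) (D : Measure ℝ) :=
  (hD.1.sub (memLp_const a)).integrable_sq

theorem integral_centered_sq_le (hσ : 0 ≤ σ) (hD : D ∈ family lam σ) :
    ∫ x, (x - mean D) ^ 2 ∂(D : Measure ℝ) ≤ σ ^ 2 := by
  have h := hD.2.2
  rw [stdDev, Real.sqrt_le_left hσ, variance_eq_integral measurable_id.aemeasurable] at h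
  exact h

theorem chebyshev_abs (hσ : 0 ≤ σ) (hD : D ∈ family lam σ) {a : ℝ} (ha : 0 < a) :
    (D : Measure ℝ).real {x | a ≤ |x - mean D|} ≤ σ ^ 2 / a ^ 2 := by
  have hm : MeasurableSet {x : ℝ | a ≤ |x - mean D|} :=
    measurableSet_le measurable_const (by fun_prop)
  rw [le_div_iff₀ (by positivity), ← integral_indicator_one hm, ← integral_mul_const]
  refine (integral_mono_of_nonneg (Filter.Eventually.of_forall fun x => ?_)
    (integrable_centered_sq hD (mean D)) (Filter.Eventually.of_forall fun x => ?_)).trans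
    (integral_centered_sq_le hσ hD)
  · exact mul_nonneg (indicator_nonneg (fun _ _ => zero_le_one) _) (by positivity)
  · dsimp only
    by_cases hx : a ≤ |x - mean D|
    · rw [indicator_of_mem (by exact hx), Pi.one_apply, one_mul, ← sq_abs (x - mean D)]
      gcongr
    · rw [indicator_of_notMem (by exact hx), zero_mul]
      positivity

theorem chebyshev_of_subset (hσ : 0 < σ) (hD : D ∈ family lam σ) {a : ℝ} (ha : 0 < a) {A : Set ℝ}
    (hA : ∀ x ∈ A, a * σ ≤ |x - mean D|) : (D : Measure ℝ).real A ≤ 1 / a ^ 2 := by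
  refine (measureReal_mono (s₂ := {x | a * σ ≤ |x - mean D|}) hA).trans
    ((chebyshev_abs hσ.le hD (by positivity)).trans (le_of_eq ?_))
  field_simp

/-- The one-sided Chebyshev inequality at one standard deviation; the sign `e` selects the tail. -/
theorem measureReal_lt_half (hσ : 0 < σ) (hD : D ∈ family lam σ) {e : ℝ} (he : |e| = 1)
    {A : Set ℝ} (hAm : MeasurableSet A) {k : ℝ} (hk : σ < k)
    (hA : ∀ x ∈ A, k ≤ e * (x - mean D)) : (D : Measure ℝ).real A < 1 / 2 := by
  have he2 : e ^ 2 = 1 := by rw [← sq_abs, he, one_pow]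
  have hI := integrable_id_of_family hD
  have h1 : ∫ x, (e * (x - mean D) + σ) ^ 2 ∂(D : Measure ℝ) ≤ 2 * σ ^ 2 := by
    have : ∀ x : ℝ, (e * (x - mean D) + σ) ^ 2 =
        (x - mean D) ^ 2 + (2 * e * σ * (x - mean D) + σ ^ 2) := by
      intro x
      linear_combination (x - mean D) ^ 2 * he2
    simp only [this]
    have hlin : Integrable (fun x => 2 * e * σ * (x - mean D)) (D : Measure ℝ) :=
      (hI.sub (integrable_const _)).const_mul _
    have haff : Integrable (fun x => 2 * e * σ * (x - mean D) + σ ^ 2) (D : Measure ℝ) :=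
      hlin.add (integrable_const _)
    rw [integral_add (integrable_centered_sq hD _) haff, integral_add hlin (integrable_const _),
      integral_const_mul, integral_sub hI (integrable_const _)]
    have := integral_centered_sq_le hσ.le hD
    simp only [integral_const, probReal_univ, smul_eq_mul, one_mul, mean, sub_self, mul_zero] at *
    linarith
  have h2 : (D : Measure ℝ).real A * (k + σ) ^ 2 ≤ 2 * σ ^ 2 := by
    rw [← integral_indicator_one hAm, ← integral_mul_const]
    refine (integral_mono_of_nonneg (Filter.Eventually.of_forall fun x => ?_)
      ?_ (Filter.Eventually.of_forall fun x => ?_)).trans h1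
    · exact mul_nonneg (indicator_nonneg (fun _ _ => zero_le_one) _) (by positivity)
    · exact ((((hD.1.sub (memLp_const (mean D))).const_mul e).add (memLp_const σ))).integrable_sq
    · by_cases hx : x ∈ A
      · rw [indicator_of_mem hx, Pi.one_apply, one_mul]
        have := hA x hx
        have : 0 ≤ k + σ := by linarith
        gcongr
      · rw [indicator_of_notMem hx, zero_mul]
        positivity
  have h3 : (2 * σ) ^ 2 < (k + σ) ^ 2 := by gcongr; linarith
  by_contra! hc
  nlinarith [mul_le_mul_of_nonneg_right hc (sq_nonneg (k + σ))]

theorem measure_Ici_lt_half (hσ : 0 < σ) (hD : D ∈ family lam σ) {s : ℝ} (hs : mean D + σ < s) :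
    (D : Measure ℝ).real (Ici s) < 1 / 2 :=
  measureReal_lt_half hσ hD (e := 1) (by simp) measurableSet_Ici (k := s - mean D) (by linarith)
    fun x hx => by linarith [mem_Ici.1 hx]

theorem measure_Iic_lt_half (hσ : 0 < σ) (hD : D ∈ family lam σ) {s : ℝ} (hs : s < mean D - σ) :
    (D : Measure ℝ).real (Iic s) < 1 / 2 :=
  measureReal_lt_half hσ hD (e := -1) (by simp) measurableSet_Iic (k := mean D - s) (by linarith)
    fun x hx => by linarith [mem_Iic.1 hx]

theorem half_le_measure_iff {A : Set ℝ} :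
    1 / 2 ≤ (D : Measure ℝ) A ↔ 1 / 2 ≤ (D : Measure ℝ).real A := by
  rw [measureReal_def, show (1 / 2 : ENNReal) = ENNReal.ofReal (1 / 2) by
    rw [ENNReal.ofReal_div_of_pos (by norm_num)]; simp]
  exact ENNReal.ofReal_le_iff_le_toReal (measure_ne_top _ _)

theorem isMedian_iff {M : ℝ} : IsMedian D M ↔
    1 / 2 ≤ (D : Measure ℝ).real (Iic M) ∧ 1 / 2 ≤ (D : Measure ℝ).real (Ici M) := by
  rw [IsMedian, half_le_measure_iff, half_le_measure_iff]

theorem IsMedian.abs_sub_mean_le (hσ : 0 < σ) (hD : D ∈ family lam σ) {M : ℝ}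
    (hM : IsMedian D M) : |M - mean D| ≤ σ := by
  rw [isMedian_iff] at hM
  rw [abs_le]
  constructor
  · by_contra! h
    linarith [measure_Iic_lt_half hσ hD (s := M) (by linarith)]
  · by_contra! h
    linarith [measure_Ici_lt_half hσ hD (s := M) (by linarith)]

/-- The infimum of the points with at least half of the mass on their left is a median. -/
theorem exists_isMedian (hσ : 0 < σ) (hD : D ∈ family lam σ) : ∃ M, IsMedian D M := by
  set S : Set ℝ := {x | 1 / 2 ≤ (D : Measure ℝ).real (Iic x)} with hS
  have hmono : ∀ {x y : ℝ}, x ≤ y →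
      (D : Measure ℝ).real (Iic x) ≤ (D : Measure ℝ).real (Iic y) :=
    fun h => measureReal_mono (Iic_subset_Iic.2 h)
  have hcompl : ∀ x : ℝ, (D : Measure ℝ).real (Ioi x) = 1 - (D : Measure ℝ).real (Iic x) := by
    intro x
    rw [← compl_Iic, probReal_compl_eq_one_sub measurableSet_Iic]
  have hne : S.Nonempty := by
    refine ⟨mean D + 2 * σ, ?_⟩
    have h1 := measure_Ici_lt_half hσ hD (s := mean D + 2 * σ) (by linarith)
    have h2 := hcompl (mean D + 2 * σ)
    have h3 := measureReal_mono (μ := (D : Measure ℝ)) (Ioi_subset_Ici_self (a := mean D + 2 * σ))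
    change 1 / 2 ≤ (D : Measure ℝ).real (Iic (mean D + 2 * σ))
    linarith
  have hbdd : BddBelow S := by
    refine ⟨mean D - σ, fun x hx => ?_⟩
    by_contra! h
    have h1 := measure_Iic_lt_half hσ hD h
    have h2 : 1 / 2 ≤ (D : Measure ℝ).real (Iic x) := hx
    linarith
  have hlim : ∀ (A : ℕ → Set ℝ), Antitone A → (∀ n, MeasurableSet (A n)) →
      (∀ n, 1 / 2 ≤ (D : Measure ℝ).real (A n)) → 1 / 2 ≤ (D : Measure ℝ) (⋂ n, A n) := by
    intro A hA hm h
    exact ge_of_tendsto' (tendsto_measure_iInter_atTop (fun n => (hm n).nullMeasurableSet) hA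
      ⟨0, measure_ne_top _ _⟩) fun n => half_le_measure_iff.2 (h n)
  have hdecr : ∀ {m n : ℕ}, m ≤ n → 1 / ((n : ℝ) + 1) ≤ 1 / ((m : ℝ) + 1) :=
    fun h => Nat.one_div_le_one_div h
  refine ⟨sInf S, ?_, ?_⟩
  · have : Iic (sInf S) = ⋂ n : ℕ, Iic (sInf S + 1 / ((n : ℝ) + 1)) := by
      ext x
      simp only [mem_Iic, mem_iInter]
      refine ⟨fun h n => h.trans (by simp; positivity), fun h => ?_⟩
      refine le_of_forall_pos_le_add fun e he => ?_
      obtain ⟨n, hn⟩ := exists_nat_one_div_lt he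
      linarith [h n]
    rw [this]
    refine hlim _ (fun m n h => Iic_subset_Iic.2 (by linarith [hdecr h]))
      (fun n => measurableSet_Iic) fun n => ?_
    obtain ⟨s, hs, hlt⟩ := exists_lt_of_csInf_lt hne
      (show sInf S < sInf S + 1 / ((n : ℝ) + 1) by simp; positivity)
    exact le_trans hs (hmono hlt.le)
  · have : Ici (sInf S) = ⋂ n : ℕ, Ioi (sInf S - 1 / ((n : ℝ) + 1)) := by
      ext x
      simp only [mem_Ici, mem_Ioi, mem_iInter]
      refine ⟨fun h n => lt_of_lt_of_le (by simp; positivity) h, fun h => ?_⟩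
      refine le_of_forall_pos_le_add fun e he => ?_
      obtain ⟨n, hn⟩ := exists_nat_one_div_lt he
      linarith [h n]
    rw [this]
    refine hlim _ (fun m n h => Ioi_subset_Ioi (by linarith [hdecr h]))
      (fun n => measurableSet_Ioi) fun n => ?_
    have hlt : sInf S - 1 / ((n : ℝ) + 1) ∉ S :=
      notMem_of_lt_csInf (by simp; positivity) hbdd
    rw [hcompl]
    have : (D : Measure ℝ).real (Iic (sInf S - 1 / ((n : ℝ) + 1))) < 1 / 2 := not_le.1 hlt
    linarith

end Tails

/-! ### The regions -/

section Regions

theorem bp_zero : bp 0 = 0 := rfl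

theorem bp_succ_of_four_le {i : ℕ} (hi : 4 ≤ i) : bp (i + 1) = 2 * (bp i - 3) := by
  rw [bp, if_neg (by omega)]

theorem bp_of_le_four {i : ℕ} (h0 : 0 < i) (hi : i ≤ 4) : bp i = 2 ^ i := by
  obtain ⟨k, rfl⟩ := Nat.exists_eq_succ_of_ne_zero h0.ne'
  rw [Nat.succ_eq_add_one, bp, if_pos hi]

theorem bp_add_four (k : ℕ) : bp (k + 4) = 6 + 10 * 2 ^ k := by
  induction k with
  | zero => rw [zero_add, bp_of_le_four (by norm_num) le_rfl]; norm_num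
  | succ k ih =>
    rw [show k + 1 + 4 = (k + 4) + 1 by ring, bp_succ_of_four_le (by omega), ih]
    ring

theorem bp_strictMono : StrictMono bp := by
  refine strictMono_nat_of_lt_succ fun n => ?_
  rcases lt_or_ge n 4 with h | h
  · rw [bp_of_le_four (i := n + 1) (by omega) (by omega)]
    rcases Nat.eq_zero_or_pos n with rfl | h0
    · norm_num [bp_zero]
    · rw [bp_of_le_four h0 h.le]
      exact pow_lt_pow_right₀ (by norm_num) (by omega)
  · obtain ⟨k, rfl⟩ := Nat.exists_eq_add_of_le' h
    rw [show k + 4 + 1 = (k + 1) + 4 by ring, bp_add_four, bp_add_four, pow_succ]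
    have : (0 : ℝ) < 2 ^ k := by positivity
    linarith

theorem bp_nonneg (i : ℕ) : 0 ≤ bp i := bp_zero ▸ bp_strictMono.monotone (Nat.zero_le i)

theorem bp_pos {i : ℕ} (hi : 0 < i) : 0 < bp i := bp_zero ▸ bp_strictMono hi

variable {σ : ℝ}

theorem natAbs_succ (j : ℕ) : ((j : ℤ) + 1).natAbs = j + 1 := by omega

theorem natAbs_neg_succ (j : ℕ) : (-((j : ℤ) + 1)).natAbs = j + 1 := by omega

theorem lo_succ (j : ℕ) : lo σ (j + 1) = bp j * σ := by
  rw [lo, if_pos (by omega), natAbs_succ, Nat.add_sub_cancel]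

theorem hi_succ (j : ℕ) : hi σ (j + 1) = bp (j + 1) * σ := by
  rw [hi, if_pos (by omega), natAbs_succ]

theorem lo_neg_succ (j : ℕ) : lo σ (-(j + 1)) = -(bp (j + 1) * σ) := by
  rw [lo, if_neg (by omega), natAbs_neg_succ]

theorem hi_neg_succ (j : ℕ) : hi σ (-(j + 1)) = -(bp j * σ) := by
  rw [hi, if_neg (by omega), natAbs_neg_succ, Nat.add_sub_cancel]

theorem region_succ (j : ℕ) : region σ (j + 1) = Ico (bp j * σ) (bp (j + 1) * σ) := by
  rw [region, if_pos (by omega), lo_succ, hi_succ]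

theorem region_neg_succ (j : ℕ) :
    region σ (-(j + 1)) = Ioc (-(bp (j + 1) * σ)) (-(bp j * σ)) := by
  rw [region, if_neg (by omega), lo_neg_succ, hi_neg_succ]

theorem exists_eq_succ_or_neg_succ {i : ℤ} (hi : i ≠ 0) :
    ∃ j : ℕ, i = j + 1 ∨ i = -(j + 1) := by
  refine ⟨i.natAbs - 1, ?_⟩
  omega

theorem lo_lt_hi (hσ : 0 < σ) {i : ℤ} (hi0 : i ≠ 0) : lo σ i < hi σ i := by
  obtain ⟨j, rfl | rfl⟩ := exists_eq_succ_or_neg_succ hi0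
  · rw [lo_succ, hi_succ]
    exact mul_lt_mul_of_pos_right (bp_strictMono (Nat.lt_succ_self j)) hσ
  · rw [lo_neg_succ, hi_neg_succ]
    exact neg_lt_neg (mul_lt_mul_of_pos_right (bp_strictMono (Nat.lt_succ_self j)) hσ)

theorem abs_lo_add_abs_hi (hσ : 0 < σ) {i : ℤ} (hi0 : i ≠ 0) :
    |lo σ i| + |hi σ i| = (bp (i.natAbs - 1) + bp i.natAbs) * σ := by
  have h : ∀ j, |bp j * σ| = bp j * σ := fun j => abs_of_nonneg (mul_nonneg (bp_nonneg j) hσ.le)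
  obtain ⟨j, rfl | rfl⟩ := exists_eq_succ_or_neg_succ hi0
  · rw [lo_succ, hi_succ, natAbs_succ, Nat.add_sub_cancel, h, h]
    ring
  · rw [lo_neg_succ, hi_neg_succ, natAbs_neg_succ, Nat.add_sub_cancel, abs_neg, abs_neg, h, h]
    ring

theorem abs_lo_add_abs_hi_pos (hσ : 0 < σ) {i : ℤ} (hi0 : i ≠ 0) : 0 < |lo σ i| + |hi σ i| := by
  rw [abs_lo_add_abs_hi hσ hi0]
  have := bp_pos (i := i.natAbs) (by omega)
  have := bp_nonneg (i.natAbs - 1)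
  positivity

theorem region_subset_Icc (i : ℤ) : region σ i ⊆ Icc (lo σ i) (hi σ i) := by
  unfold region
  split_ifs
  · exact Ico_subset_Icc_self
  · exact Ioc_subset_Icc_self

theorem le_abs_of_mem_region {i : ℤ} (hi0 : i ≠ 0) {y : ℝ} (hy : y ∈ region σ i) :
    bp (i.natAbs - 1) * σ ≤ |y| := by
  obtain ⟨j, rfl | rfl⟩ := exists_eq_succ_or_neg_succ hi0
  · rw [region_succ] at hy
    rw [natAbs_succ, Nat.add_sub_cancel]
    exact hy.1.trans (le_abs_self y)
  · rw [region_neg_succ] at hy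
    rw [natAbs_neg_succ, Nat.add_sub_cancel]
    exact (by linarith [hy.2] : bp j * σ ≤ -y).trans (neg_le_abs y)

theorem measurableSet_region (i : ℤ) : MeasurableSet (region σ i) := by
  unfold region
  split_ifs
  · exact measurableSet_Ico
  · exact measurableSet_Ioc

theorem measurableSet_queryLo (i : ℤ) : MeasurableSet
    {x : ℝ × ℝ × unitInterval | x.2.1 ∈ queryLo x.1 σ i x.2.2} := by
  refine MeasurableSet.inter (s₁ := {x : ℝ × ℝ × unitInterval | x.2.1 - x.1 ∈ region σ i})
    (s₂ := {x : ℝ × ℝ × unitInterval | x.2.1 - x.1 ≤ thr σ i x.2.2}) ?_ ?_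
  · exact (measurableSet_region i).preimage
      (f := fun x : ℝ × ℝ × unitInterval => x.2.1 - x.1) (by fun_prop)
  · exact measurableSet_le (by fun_prop) (by unfold thr; fun_prop)

theorem measurableSet_queryHi (i : ℤ) : MeasurableSet
    {x : ℝ × ℝ × unitInterval | x.2.1 ∈ queryHi x.1 σ i x.2.2} := by
  refine MeasurableSet.inter (s₁ := {x : ℝ × ℝ × unitInterval | x.2.1 - x.1 ∈ region σ i})
    (s₂ := {x : ℝ × ℝ × unitInterval | thr σ i x.2.2 ≤ x.2.1 - x.1}) ?_ ?_
  · exact (measurableSet_region i).preimage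
      (f := fun x : ℝ × ℝ × unitInterval => x.2.1 - x.1) (by fun_prop)
  · exact measurableSet_le (by unfold thr; fun_prop) (by fun_prop)

theorem measurableSet_answerSet_queryLo (c : ℝ) (i : ℤ) :
    MeasurableSet (answerSet (queryLo c σ i)) :=
  (measurableSet_queryLo i).preimage (f := fun z : ℝ × unitInterval => (c, z))
    measurable_prodMk_left

theorem measurableSet_answerSet_queryHi (c : ℝ) (i : ℤ) :
    MeasurableSet (answerSet (queryHi c σ i)) :=
  (measurableSet_queryHi i).preimage (f := fun z : ℝ × unitInterval => (c, z))
    measurable_prodMk_left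

variable (D : ProbabilityMeasure ℝ)

theorem queryProb_eq_integral {Q : unitInterval → Set ℝ} (hQ : MeasurableSet (answerSet Q)) :
    queryProb D Q = ∫ x, (volume : Measure unitInterval).real {u | x ∈ Q u} ∂(D : Measure ℝ) := by
  rw [queryProb, law, measureReal_def, Measure.prod_apply hQ]
  exact (integral_toReal (measurable_measure_prodMk_left hQ).aemeasurable
    (Filter.Eventually.of_forall fun x => measure_lt_top _ _)).symm

theorem integrable_section {Q : unitInterval → Set ℝ} (hQ : MeasurableSet (answerSet Q)) :
    Integrable (fun x => (volume : Measure unitInterval).real {u | x ∈ Q u}) (D : Measure ℝ) := by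
  refine Integrable.of_mem_Icc 0 1
    (measurable_measure_prodMk_left hQ).ennreal_toReal.aemeasurable
    (Filter.Eventually.of_forall fun x => ⟨measureReal_nonneg, measureReal_le_one⟩)

/-- The contribution of region `i` to the mean of the centred distribution. -/
def regionMean (c σ : ℝ) (i : ℤ) : ℝ :=
  ∫ x, (region σ i).indicator id (x - c) ∂(D : Measure ℝ)

/-- A uniformly random threshold between `a` and `b` rounds a point of `[a, b]` to one of the two
endpoints without changing its expectation. -/
theorem lo_mul_queryProb_add (hσ : 0 < σ) (c : ℝ) {i : ℤ} (hi0 : i ≠ 0) :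
    lo σ i * queryProb D (queryLo c σ i) + hi σ i * queryProb D (queryHi c σ i) =
      regionMean D c σ i := by
  have hL := measurableSet_answerSet_queryLo (σ := σ) c i
  have hH := measurableSet_answerSet_queryHi (σ := σ) c i
  rw [queryProb_eq_integral D hL, queryProb_eq_integral D hH, ← integral_const_mul,
    ← integral_const_mul, ← integral_add ((integrable_section D hL).const_mul _)
      ((integrable_section D hH).const_mul _), regionMean]
  refine integral_congr_ae (Filter.Eventually.of_forall fun x => ?_)
  dsimp only
  have hlt := lo_lt_hi hσ hi0
  by_cases hx : x - c ∈ region σ i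
  · rw [indicator_of_mem hx, id]
    have hIcc := region_subset_Icc i hx
    have hd : 0 < hi σ i - lo σ i := by linarith
    set a : unitInterval := ⟨(x - c - lo σ i) / (hi σ i - lo σ i),
      div_nonneg (by linarith [hIcc.1]) hd.le, (div_le_one hd).2 (by linarith [hIcc.2])⟩ with ha
    have hav : (a : ℝ) = (x - c - lo σ i) / (hi σ i - lo σ i) := rfl
    have h1 : {u | x ∈ queryLo c σ i u} = Ici a := by
      ext u
      rw [mem_Ici, ← Subtype.coe_le_coe, hav, div_le_iff₀ hd]
      simp only [queryLo, thr, mem_ofPred_eq]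
      constructor
      · rintro ⟨-, h⟩; linarith
      · intro h; exact ⟨hx, by linarith⟩
    have h2 : {u | x ∈ queryHi c σ i u} = Iic a := by
      ext u
      rw [mem_Iic, ← Subtype.coe_le_coe, hav, le_div_iff₀ hd]
      simp only [queryHi, thr, mem_ofPred_eq]
      constructor
      · rintro ⟨-, h⟩; linarith
      · intro h; exact ⟨hx, by linarith⟩
    rw [h1, h2, measureReal_def, measureReal_def, unitInterval.volume_Ici,
      unitInterval.volume_Iic, ENNReal.toReal_ofReal (by linarith [a.2.2]),
      ENNReal.toReal_ofReal a.2.1, hav]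
    field_simp
    ring
  · rw [indicator_of_notMem hx]
    have h1 : {u | x ∈ queryLo c σ i u} = ∅ := eq_empty_of_forall_notMem fun u hu => hx hu.1
    have h2 : {u | x ∈ queryHi c σ i u} = ∅ := eq_empty_of_forall_notMem fun u hu => hx hu.1
    simp [h1, h2]

theorem queryProb_le_of_subset {Q : unitInterval → Set ℝ} {A : Set ℝ} (h : ∀ u, Q u ⊆ A) :
    queryProb D Q ≤ (D : Measure ℝ).real A := by
  have h1 : answerSet Q ⊆ A ×ˢ univ := fun z hz => ⟨h _ hz, mem_univ _⟩
  refine (measureReal_mono h1).trans (le_of_eq ?_)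
  rw [law, measureReal_def, Measure.prod_prod, measure_univ, mul_one, measureReal_def]

/-- The regions tile `(-m σ, m σ)`; the point `0` lies in both of the innermost regions, which does
no harm since its contribution to the mean is zero. -/
theorem sum_indicator_region (hσ : 0 < σ) (y : ℝ) (k : ℕ) :
    ∑ j ∈ Finset.range k, ((region σ (j + 1)).indicator id y +
      (region σ (-(j + 1))).indicator id y) = {y : ℝ | |y| < bp k * σ}.indicator id y := by
  induction k with
  | zero =>
    rw [indicator_of_notMem]
    · simp
    · simp [bp_zero]
  | succ k ih =>
    rw [Finset.sum_range_succ, ih, region_succ, region_neg_succ]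
    have h0 : 0 ≤ bp k * σ := mul_nonneg (bp_nonneg k) hσ.le
    have h1 : bp k * σ < bp (k + 1) * σ :=
      mul_lt_mul_of_pos_right (bp_strictMono (Nat.lt_succ_self k)) hσ
    simp only [indicator_apply, mem_Ico, mem_Ioc, mem_ofPred_eq, id, abs_lt]
    split_ifs <;> first | (exfalso; grind) | grind

theorem sum_regionMean {lam : ℝ} (hσ : 0 < σ) (hD : D ∈ family lam σ) (c : ℝ) (k : ℕ) :
    ∑ j ∈ Finset.range k, (regionMean D c σ (j + 1) + regionMean D c σ (-(j + 1))) =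
      ∫ x, {y : ℝ | |y| < bp k * σ}.indicator id (x - c) ∂(D : Measure ℝ) := by
  have hint : ∀ i : ℤ, Integrable (fun x => (region σ i).indicator id (x - c))
      (D : Measure ℝ) := by
    intro i
    have := ((integrable_id_of_family hD).sub (integrable_const c)).indicator
      ((measurableSet_region (σ := σ) i).preimage (measurable_id.sub_const c))
    exact this
  have hadd : ∀ j : ℕ, Integrable (fun x => (region σ (j + 1)).indicator id (x - c) +
      (region σ (-(j + 1))).indicator id (x - c)) (D : Measure ℝ) :=
    fun j => (hint _).add (hint _)
  simp only [← sum_indicator_region hσ]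
  rw [integral_finsetSum _ fun j _ => hadd j]
  refine Finset.sum_congr rfl fun j _ => ?_
  rw [integral_add (hint _) (hint _)]
  rfl

/-- The bias caused by ignoring the part of the distribution at distance at least `m σ` from the
centre. -/
theorem abs_truncation_bias_le {lam c m : ℝ} (hσ : 0 < σ) (hD : D ∈ family lam σ)
    (hc : |c - mean D| ≤ 3 * σ) (hm : 3 < m) :
    |c + ∫ x, {y : ℝ | |y| < m * σ}.indicator id (x - c) ∂(D : Measure ℝ) - mean D| ≤
      σ * (1 / (m - 3) + 3 / (m - 3) ^ 2) := by
  have hI := integrable_id_of_family hD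
  have hms : MeasurableSet {y : ℝ | |y| < m * σ} :=
    measurableSet_lt (by fun_prop) measurable_const
  have hId : Integrable (fun x : ℝ => x - c) (D : Measure ℝ) := hI.sub (integrable_const c)
  have hint1 : Integrable (fun x => {y : ℝ | |y| < m * σ}.indicator id (x - c))
      (D : Measure ℝ) :=
    hId.indicator (hms.preimage (measurable_id.sub_const c))
  have h1 : c + ∫ x, {y : ℝ | |y| < m * σ}.indicator id (x - c) ∂(D : Measure ℝ) - mean D =
      ∫ x, ({y : ℝ | |y| < m * σ}.indicator id (x - c) - (x - c)) ∂(D : Measure ℝ) := by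
    rw [integral_sub hint1 hId, integral_sub hI (integrable_const c)]
    simp only [integral_const, probReal_univ, smul_eq_mul, one_mul, mean]
    ring
  set a := m - 3 with ha
  have ha0 : 0 < a := by linarith
  set K := 1 / (a * σ) + 3 / (a ^ 2 * σ) with hK
  have hK0 : 0 ≤ K := by positivity
  rw [h1]
  refine (abs_integral_le_integral_abs).trans ?_
  refine (integral_mono_of_nonneg (g := fun x => K * (x - mean D) ^ 2)
    (Filter.Eventually.of_forall fun x => abs_nonneg _)
    ((integrable_centered_sq hD _).const_mul K) (Filter.Eventually.of_forall fun x => ?_)).trans ?_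
  · dsimp only
    by_cases hx : |x - c| < m * σ
    · rw [indicator_of_mem (by exact hx), id, sub_self, abs_zero]
      positivity
    · rw [indicator_of_notMem (by exact hx), zero_sub, abs_neg]
      push Not at hx
      have h2 : |x - c| ≤ |x - mean D| + 3 * σ := by
        have := abs_sub_le x (mean D) c
        rw [abs_sub_comm (mean D) c] at this
        linarith
      set z := |x - mean D| with hz
      have hz1 : a * σ ≤ z := by rw [ha]; linarith
      have haσ : 0 < a * σ := by positivity
      rw [← sq_abs (x - mean D), ← hz]
      -- The integrand is at most `z + 3 σ`, and both terms are dominated by `z ^ 2` as `z ≥ a σ`.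
      have h3 : z ≤ 1 / (a * σ) * z ^ 2 := by
        rw [div_mul_eq_mul_div, one_mul, le_div_iff₀ haσ]
        nlinarith
      have h4 : 3 * σ ≤ 3 / (a ^ 2 * σ) * z ^ 2 := by
        rw [div_mul_eq_mul_div, le_div_iff₀ (by positivity)]
        nlinarith [mul_self_le_mul_self haσ.le hz1]
      rw [hK, add_mul]
      linarith
  · rw [integral_const_mul]
    refine (mul_le_mul_of_nonneg_left (integral_centered_sq_le hσ.le hD) hK0).trans (le_of_eq ?_)
    rw [hK]
    field_simp

end Regions

/-! ### Correctness of the refinement step -/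

section Refinement

variable {ε δ σ : ℝ}

theorem iMax_spec (hε : 0 < ε) (hσ : 0 < σ) :
    5 ≤ iMax ε σ ∧ ((2 : ℝ) ^ iMax ε σ)⁻¹ ≤ 5 * ε / (128 * σ) := by
  have hne : {i : ℕ | 5 ≤ i ∧ ((2 : ℝ) ^ i)⁻¹ ≤ 5 * ε / (128 * σ)}.Nonempty := by
    obtain ⟨n, hn⟩ := exists_pow_lt_of_lt_one (show 0 < 5 * ε / (128 * σ) by positivity)
      (show (2 : ℝ)⁻¹ < 1 by norm_num)
    refine ⟨max 5 n, le_max_left _ _, ?_⟩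
    rw [← inv_pow]
    exact (pow_le_pow_of_le_one (by norm_num) (by norm_num) (le_max_right 5 n)).trans hn.le
  exact Nat.sInf_mem hne

theorem iMax_pos (hε : 0 < ε) (hσ : 0 < σ) : (0 : ℝ) < iMax ε σ := by
  have := (iMax_spec hε hσ).1
  exact_mod_cast (by omega : 0 < iMax ε σ)

theorem epsReg_pos (hε : 0 < ε) (hσ : 0 < σ) {i : ℤ} (hi : i ≠ 0) : 0 < epsReg ε σ i := by
  have := iMax_pos hε hσ
  have := abs_lo_add_abs_hi_pos hσ hi
  unfold epsReg
  positivity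

theorem deltaReg_pos (hε : 0 < ε) (hσ : 0 < σ) (hδ : 0 < δ) : 0 < deltaReg ε δ σ := by
  have := iMax_pos hε hσ
  unfold deltaReg
  positivity

theorem deltaReg_lt_one (hε : 0 < ε) (hσ : 0 < σ) (hδ1 : δ < 1) : deltaReg ε δ σ < 1 := by
  have h := iMax_pos hε hσ
  have h5 : (5 : ℝ) ≤ iMax ε σ := by exact_mod_cast (iMax_spec hε hσ).1
  unfold deltaReg
  rw [div_lt_one (by positivity)]
  linarith

theorem log_two_div_deltaReg_pos (hε : 0 < ε) (hσ : 0 < σ) (hδ : 0 < δ) (hδ1 : δ < 1) :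
    0 < Real.log (2 / deltaReg ε δ σ) := by
  apply Real.log_pos
  rw [one_lt_div (deltaReg_pos hε hσ hδ)]
  linarith [deltaReg_lt_one hε hσ hδ1]

theorem nReg_pos (hε : 0 < ε) (hσ : 0 < σ) (hδ : 0 < δ) (hδ1 : δ < 1) {i : ℤ} (hi : i ≠ 0) :
    0 < nReg ε δ σ i := by
  have h1 := epsReg_pos hε hσ hi
  have h2 := log_two_div_deltaReg_pos hε hσ hδ hδ1
  have h3 := bp_pos (i := i.natAbs) (by omega)
  unfold nReg
  split_ifs <;> exact Nat.ceil_pos.2 (by positivity)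

variable {D : ProbabilityMeasure ℝ} {lam c : ℝ}

/-- The far regions have small probability, which is why fewer samples suffice there. -/
theorem measure_region_le (hσ : 0 < σ) (hD : D ∈ family lam σ) (hc : |c - mean D| ≤ 3 * σ)
    {i : ℤ} (hi : 5 ≤ i.natAbs) :
    (D : Measure ℝ).real {x | x - c ∈ region σ i} ≤ 4 / bp i.natAbs ^ 2 := by
  obtain ⟨k, hk⟩ := Nat.exists_eq_add_of_le' hi
  have h1 : bp (i.natAbs - 1) = 6 + 10 * 2 ^ k := by
    rw [hk, show k + 5 - 1 = k + 4 by omega, bp_add_four]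
  have h2 : bp i.natAbs = 2 * (bp (i.natAbs - 1) - 3) := by
    rw [hk, show k + 5 - 1 = k + 4 by omega, show k + 5 = k + 4 + 1 by ring,
      bp_succ_of_four_le (by omega)]
  have h2k : (0 : ℝ) < 2 ^ k := by positivity
  have ha : 0 < bp (i.natAbs - 1) - 3 := by rw [h1]; linarith
  refine (chebyshev_of_subset hσ hD ha fun x hx => ?_).trans (le_of_eq ?_)
  · have h3 := le_abs_of_mem_region (by omega) (show x - c ∈ region σ i from hx)
    have h4 := abs_sub_le x (mean D) c
    rw [abs_sub_comm (mean D) c] at h4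
    linarith
  · rw [h2]
    field_simp
    norm_num

theorem pr_count_query_le (hσ : 0 < σ) (hD : D ∈ family lam σ) (hε : 0 < ε) (hδ : 0 < δ)
    (hδ1 : δ < 1) (hc : |c - mean D| ≤ 3 * σ) {i : ℤ} (hi : i ≠ 0) {Q : unitInterval → Set ℝ}
    (hQ : MeasurableSet (answerSet Q)) (hQs : ∀ u, Q u ⊆ {x | x - c ∈ region σ i}) :
    Protocol.pr D (Protocol.count Q (nReg ε δ σ i))
      {s | epsReg ε σ i < |(s : ℝ) / nReg ε δ σ i - queryProb D Q|} ≤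
      ENNReal.ofReal (deltaReg ε δ σ) := by
  have he := epsReg_pos hε hσ hi
  have hd := deltaReg_pos hε hσ hδ
  have hn := nReg_pos hε hσ hδ hδ1 hi
  by_cases h : i.natAbs ≤ 4
  · refine pr_count_hoeffding D hQ he hd hn ?_
    rw [nReg, if_pos h]
    exact Nat.le_ceil _
  · have hb := bp_pos (i := i.natAbs) (by omega)
    refine pr_count_bernstein D hQ he hd (V := 4 / bp i.natAbs ^ 2) (by positivity)
      ((queryProb_le_of_subset D hQs).trans (measure_region_le hσ hD hc (by omega))) hn ?_
    rw [nReg, if_neg h]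
    refine le_trans (le_of_eq ?_) (Nat.le_ceil _)
    congr 2
    field_simp
    norm_num

theorem pr_regionEstimate_le (hσ : 0 < σ) (hD : D ∈ family lam σ) (hε : 0 < ε) (hδ : 0 < δ)
    (hδ1 : δ < 1) (hc : |c - mean D| ≤ 3 * σ) {i : ℤ} (hi0 : i ≠ 0) :
    Protocol.pr D (regionEstimate c ε δ σ i)
      {y | ε / (4 * iMax ε σ) < |y - regionMean D c σ i|} ≤
      ENNReal.ofReal (deltaReg ε δ σ) + ENNReal.ofReal (deltaReg ε δ σ) := by
  refine (Protocol.pr_bind_le D _ _ (c := ENNReal.ofReal (deltaReg ε δ σ)) fun ka hka => ?_).trans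
    (add_le_add (pr_count_query_le hσ hD hε hδ hδ1 hc hi0
      (measurableSet_answerSet_queryLo c i) fun u x hx => hx.1) le_rfl)
  rw [Protocol.pr_map]
  refine (Protocol.pr_mono D (fun kb hkb => ?_) _).trans (pr_count_query_le hσ hD hε hδ hδ1 hc hi0
    (measurableSet_answerSet_queryHi c i) fun u x hx => hx.1)
  by_contra hkb'
  have h1 : |(ka : ℝ) / nReg ε δ σ i - queryProb D (queryLo c σ i)| ≤ epsReg ε σ i := not_lt.1 hka
  have h2 : |(kb : ℝ) / nReg ε δ σ i - queryProb D (queryHi c σ i)| ≤ epsReg ε σ i := not_lt.1 hkb'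
  refine (not_lt.2 ?_) (show ε / (4 * iMax ε σ) < |lo σ i * ((ka : ℝ) / nReg ε δ σ i) +
    hi σ i * ((kb : ℝ) / nReg ε δ σ i) - regionMean D c σ i| from hkb)
  rw [← lo_mul_queryProb_add D hσ c hi0]
  set pa := (ka : ℝ) / nReg ε δ σ i
  set pb := (kb : ℝ) / nReg ε δ σ i
  calc |lo σ i * pa + hi σ i * pb - (lo σ i * queryProb D (queryLo c σ i) +
        hi σ i * queryProb D (queryHi c σ i))|
      = |lo σ i * (pa - queryProb D (queryLo c σ i)) +
          hi σ i * (pb - queryProb D (queryHi c σ i))| := by congr 1; ring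
    _ ≤ |lo σ i| * epsReg ε σ i + |hi σ i| * epsReg ε σ i := by
        refine (abs_add_le _ _).trans ?_
        rw [abs_mul, abs_mul]
        gcongr
    _ = ε / (4 * iMax ε σ) := by
        have := iMax_pos hε hσ
        have := abs_lo_add_abs_hi_pos hσ hi0
        rw [epsReg]
        field_simp

theorem pr_pairEstimate_le (hσ : 0 < σ) (hD : D ∈ family lam σ) (hε : 0 < ε) (hδ : 0 < δ)
    (hδ1 : δ < 1) (hc : |c - mean D| ≤ 3 * σ) (j : ℕ) :
    Protocol.pr D (pairEstimate c ε δ σ j)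
      {y | ε / (2 * iMax ε σ) <
        |y - (regionMean D c σ (j + 1) + regionMean D c σ (-(j + 1)))|} ≤
      ENNReal.ofReal (4 * deltaReg ε δ σ) := by
  have hd := (deltaReg_pos (ε := ε) (σ := σ) hε hσ hδ).le
  have h4 : ENNReal.ofReal (4 * deltaReg ε δ σ) =
      (ENNReal.ofReal (deltaReg ε δ σ) + ENNReal.ofReal (deltaReg ε δ σ)) +
        (ENNReal.ofReal (deltaReg ε δ σ) + ENNReal.ofReal (deltaReg ε δ σ)) := by
    rw [← ENNReal.ofReal_add hd hd, ← ENNReal.ofReal_add (by positivity) (by positivity)]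
    congr 1
    ring
  rw [h4]
  refine (Protocol.pr_bind_le D _ _ fun y hy => ?_).trans
    (add_le_add (pr_regionEstimate_le hσ hD hε hδ hδ1 hc (i := j + 1) (by omega)) le_rfl)
  rw [Protocol.pr_map]
  refine (Protocol.pr_mono D (fun z hz => ?_) _).trans
    (pr_regionEstimate_le hσ hD hε hδ hδ1 hc (i := -(j + 1)) (by omega))
  by_contra hz'
  have h1 : |y - regionMean D c σ (j + 1)| ≤ ε / (4 * iMax ε σ) := not_lt.1 hy
  have h2 : |z - regionMean D c σ (-(j + 1))| ≤ ε / (4 * iMax ε σ) := not_lt.1 hz'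
  refine (not_lt.2 ?_) (show ε / (2 * iMax ε σ) <
    |y + z - (regionMean D c σ (j + 1) + regionMean D c σ (-(j + 1)))| from hz)
  have h3 : ε / (2 * iMax ε σ) = ε / (4 * iMax ε σ) + ε / (4 * iMax ε σ) := by
    have := iMax_pos hε hσ
    field_simp
    norm_num
  rw [h3, add_sub_add_comm]
  exact (abs_add_le _ _).trans (add_le_add h1 h2)

theorem truncation_bias_le_half (hσ : 0 < σ) (hε : 0 < ε) :
    3 < bp (iMax ε σ) ∧
      σ * (1 / (bp (iMax ε σ) - 3) + 3 / (bp (iMax ε σ) - 3) ^ 2) ≤ ε / 2 := by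
  obtain ⟨h5, h2⟩ := iMax_spec hε hσ
  obtain ⟨k, hk⟩ := Nat.exists_eq_add_of_le' h5
  have hb : bp (iMax ε σ) = 6 + 10 * 2 ^ (k + 1) := by
    rw [hk, show k + 5 = (k + 1) + 4 by ring, bp_add_four]
  have hk1 : (1 : ℝ) ≤ 2 ^ k := one_le_pow₀ (by norm_num)
  have hpow : (2 : ℝ) ^ iMax ε σ = 32 * 2 ^ k := by rw [hk, pow_add]; ring
  rw [hpow, inv_le_iff_one_le_mul₀ (by positivity), div_mul_eq_mul_div,
    le_div_iff₀ (by positivity)] at h2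
  rw [hb, pow_succ]
  refine ⟨by linarith, ?_⟩
  set a : ℝ := 6 + 10 * (2 ^ k * 2) - 3 with ha
  have ha0 : 20 * 2 ^ k ≤ a := by linarith
  have ha1 : 1 ≤ a := by linarith
  have h3 : 3 / a ^ 2 ≤ 3 * (1 / a) := by
    rw [mul_one_div]
    exact div_le_div_of_nonneg_left (by norm_num) (by linarith) (by nlinarith)
  have h4 : σ * (1 / a) ≤ ε / 16 := by
    rw [mul_one_div, div_le_div_iff₀ (by linarith) (by norm_num)]
    nlinarith
  nlinarith

theorem pr_refine_le (hσ : 0 < σ) (hD : D ∈ family lam σ) (hε : 0 < ε) (hδ : 0 < δ)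
    (hδ1 : δ < 1) (hc : |c - mean D| ≤ 3 * σ) :
    Protocol.pr D (refine c ε δ σ) {y | ε < |y - mean D|} ≤ ENNReal.ofReal (δ / 2) := by
  refine (Protocol.pr_map D _ _ _).le.trans ?_
  have hk := iMax_pos hε hσ
  set k := iMax ε σ with hkdef
  set t : ℕ → ℝ := fun j => regionMean D c σ (j + 1) + regionMean D c σ (-(j + 1)) with ht
  refine (Protocol.pr_mono D (B := {v | ∃ j < k, v j ∈ {y | ε / (2 * k) < |y - t j|}})
    (fun v hv => ?_) _).trans ((Protocol.pr_collect_le D _ _ _).trans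
      ((Finset.sum_le_sum fun j _ => pr_pairEstimate_le hσ hD hε hδ hδ1 hc j).trans ?_))
  · by_contra hv'
    have h1 : ∀ j < k, |v j - t j| ≤ ε / (2 * k) := by
      intro j hj
      by_contra! h
      exact hv' ⟨j, hj, h⟩
    refine (not_lt.2 ?_)
      (show ε < |c + ∑ j ∈ Finset.range k, v j - mean D| from hv)
    have h2 := abs_truncation_bias_le D hσ hD hc (truncation_bias_le_half hσ hε).1
    rw [← sum_regionMean D hσ hD] at h2
    have h3 : |∑ j ∈ Finset.range k, v j - ∑ j ∈ Finset.range k, t j| ≤ ε / 2 := by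
      rw [← Finset.sum_sub_distrib]
      refine (Finset.abs_sum_le_sum_abs _ _).trans ((Finset.sum_le_sum fun j hj =>
        h1 j (Finset.mem_range.1 hj)).trans (le_of_eq ?_))
      rw [Finset.sum_const, Finset.card_range, nsmul_eq_mul]
      field_simp
    have h4 := h2.trans (truncation_bias_le_half hσ hε).2
    calc |c + ∑ j ∈ Finset.range k, v j - mean D|
        = |(∑ j ∈ Finset.range k, v j - ∑ j ∈ Finset.range k, t j) +
            (c + ∑ j ∈ Finset.range k, t j - mean D)| := by congr 1; ring
      _ ≤ ε / 2 + ε / 2 := (abs_add_le _ _).trans (add_le_add h3 h4)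
      _ = ε := by ring
  · rw [Finset.sum_const, Finset.card_range, nsmul_eq_mul, ← ENNReal.ofReal_natCast,
      ← ENNReal.ofReal_mul (Nat.cast_nonneg _)]
    refine ENNReal.ofReal_le_ofReal (le_of_eq ?_)
    rw [deltaReg, ← hkdef]
    field_simp
    norm_num

/-! ### Measurability and correctness of the main estimator -/

theorem jointlyMeasurable_regionEstimate (ε δ σ : ℝ) (i : ℤ) :
    Protocol.JointlyMeasurable fun c => regionEstimate c ε δ σ i := by
  refine Protocol.JointlyMeasurable.bind
    (Protocol.JointlyMeasurable.count (measurableSet_queryLo i) _) ?_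
  refine Protocol.JointlyMeasurable.map ((Protocol.JointlyMeasurable.count
    (Q := fun c => queryHi c σ i) (measurableSet_queryHi i) _).comp measurable_fst) ?_
  fun_prop

theorem jointlyMeasurable_pairEstimate (ε δ σ : ℝ) (j : ℕ) :
    Protocol.JointlyMeasurable fun c => pairEstimate c ε δ σ j := by
  refine Protocol.JointlyMeasurable.bind (jointlyMeasurable_regionEstimate ε δ σ _) ?_
  refine Protocol.JointlyMeasurable.map
    ((jointlyMeasurable_regionEstimate ε δ σ _).comp measurable_fst) ?_
  fun_prop

theorem jointlyMeasurable_refine (ε δ σ : ℝ) :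
    Protocol.JointlyMeasurable fun c => refine c ε δ σ := by
  refine Protocol.JointlyMeasurable.map (Protocol.JointlyMeasurable.collect _
    fun j _ => jointlyMeasurable_pairEstimate ε δ σ j) ?_
  fun_prop

variable {loc : Localizer}

theorem measurable_run_mainEstimator (hloc : Measurable (loc.protocol lam σ (δ / 2)).run) :
    Measurable (mainEstimator loc ε δ lam σ).run := by
  refine Protocol.JointlyMeasurable.measurable_run (Θ := Unit)
    (p := fun _ => mainEstimator loc ε δ lam σ) ?_ ()
  refine Protocol.JointlyMeasurable.bind (Protocol.jointlyMeasurable_const hloc) ?_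
  exact (jointlyMeasurable_refine ε δ σ).comp
    (g := fun x : Unit × ℝ × ℝ => (x.2.1 + x.2.2) / 2) (by fun_prop)

theorem measurableSet_localized (D : ProbabilityMeasure ℝ) (σ : ℝ) : MeasurableSet
    {I : ℝ × ℝ | (∀ M, IsMedian D M → I.1 ≤ M ∧ M ≤ I.2) ∧ (I.2 + σ) - (I.1 - σ) ≤ 6 * σ} := by
  refine IsClosed.measurableSet (IsClosed.inter
    (s₁ := {I : ℝ × ℝ | ∀ M, IsMedian D M → I.1 ≤ M ∧ M ≤ I.2}) ?_
    (isClosed_le (f := fun I : ℝ × ℝ => (I.2 + σ) - (I.1 - σ)) (g := fun _ => 6 * σ)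
      (by fun_prop) (by fun_prop)))
  simp only [ofPred_forall]
  exact isClosed_iInter fun M => isClosed_iInter fun _ =>
    (isClosed_le continuous_fst continuous_const).inter (isClosed_le continuous_const continuous_snd)

theorem pr_mainEstimator_le {C : ℝ} (hloc : loc.IsMedianLocalizer C) (hlam : 0 < lam)
    (hσ : 0 < σ) (hD : D ∈ family lam σ) (hε : 0 < ε) (hδ : 0 < δ) (hδ1 : δ < 1) :
    Protocol.pr D (mainEstimator loc ε δ lam σ) {y | ε < |y - mean D|} ≤ ENNReal.ofReal δ := by
  obtain ⟨-, hm, -, hp⟩ := hloc lam σ (δ / 2) hlam hσ (by linarith) (by linarith)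
  have h1 := Protocol.pr_compl_le_of_prob_ge D hm (measurableSet_localized D σ) (by linarith)
    (hp D hD)
  refine (Protocol.pr_bind_le D _ _ (c := ENNReal.ofReal (δ / 2)) fun I hI => ?_).trans
    ((add_le_add h1 le_rfl).trans (le_of_eq ?_))
  · obtain ⟨hI1, hI2⟩ := not_not.1 hI
    -- The midpoint of `I` is within `2 σ` of a median, which is within `σ` of the mean.
    obtain ⟨M, hM⟩ := exists_isMedian hσ hD
    have h2 := abs_le.1 (hM.abs_sub_mean_le hσ hD)
    have h3 := hI1 M hM
    exact pr_refine_le hσ hD hε hδ hδ1 (abs_le.2 ⟨by linarith, by linarith⟩)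
  · rw [← ENNReal.ofReal_add (by linarith) (by linarith)]
    congr 1
    ring

end Refinement

/-! ### Noisy binary search by multiplicative weights -/

section Search

/-- The factor by which the weight of cell `j` is multiplied after the answer `b` to the query
"is `X` at most the `i`-th boundary?". The two penalties are unequal so that the neutral
probability of a positive answer is about `1 / 3`, between the levels `1 / 6` and `1 / 2` that the
search has to tell apart. -/
def factor (i : ℕ) (b : Bool) (j : ℕ) : ℝ :=
  if b then (if j < i then 1 else 9 / 10) else (if j < i then 19 / 20 else 1)

/-- The weights after the answer `b` at the boundary `i`. -/
def reweight (i : ℕ) (b : Bool) (w : ℕ → ℝ) (j : ℕ) : ℝ := w j * factor i b j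

/-- The first cell at which the cumulative weight of the cells `0, …, N - 1` reaches one half. -/
def medianCell (N : ℕ) (w : ℕ → ℝ) : ℕ :=
  sInf {m | ∑ j ∈ Finset.range N, w j ≤ 2 * ∑ j ∈ Finset.range (m + 1), w j}

/-- Noisy binary search among the cells between consecutive boundaries `g 0, …, g N`: each round
tests both boundaries of the weighted median cell and then reweights the cells. The output is the
list of the median cells of all rounds. -/
def search (g : ℕ → ℝ) (N : ℕ) : (n : ℕ) → (ℕ → ℝ) → Protocol (List ℕ) (2 * n)
  | 0, _ => .done []
  | n + 1, w =>
    .ask (fun _ => Iic (g (medianCell N w))) fun _ b =>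
      .ask (fun _ => Iic (g (medianCell N w + 1))) fun _ b' =>
        (search g N n (reweight (medianCell N w + 1) b' (reweight (medianCell N w) b w))).map
          fun l => medianCell N w :: l

/-- The median of a list of cells: the least `i` such that at least half of the entries are at
most `i`. -/
def medianVisit (l : List ℕ) : ℕ := sInf {i | l.length ≤ 2 * l.countP (· ≤ i)}

theorem factor_pos (i : ℕ) (b : Bool) (j : ℕ) : 0 < factor i b j := by
  unfold factor
  split_ifs <;> norm_num

theorem reweight_pos {w : ℕ → ℝ} (hw : ∀ j, 0 < w j) (i : ℕ) (b : Bool) (j : ℕ) :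
    0 < reweight i b w j := mul_pos (hw j) (factor_pos i b j)

variable {N : ℕ} {w : ℕ → ℝ}

theorem medianCell_spec (hw : ∀ j, 0 < w j) :
    ∑ j ∈ Finset.range N, w j ≤ 2 * ∑ j ∈ Finset.range (medianCell N w + 1), w j := by
  refine Nat.sInf_mem (s := {m | ∑ j ∈ Finset.range N, w j ≤
    2 * ∑ j ∈ Finset.range (m + 1), w j}) ⟨N, ?_⟩
  have h1 : 0 ≤ ∑ j ∈ Finset.range N, w j := Finset.sum_nonneg fun j _ => (hw j).le
  simp only [mem_ofPred_eq, Finset.sum_range_succ]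
  linarith [hw N]

theorem medianCell_lt (hw : ∀ j, 0 < w j) (hN : 0 < N) : medianCell N w < N := by
  obtain ⟨M, rfl⟩ := Nat.exists_eq_succ_of_ne_zero hN.ne'
  refine Nat.lt_succ_of_le (Nat.sInf_le ?_)
  have h1 : 0 ≤ ∑ j ∈ Finset.range (M + 1), w j := Finset.sum_nonneg fun j _ => (hw j).le
  simp only [mem_ofPred_eq, Nat.succ_eq_add_one]
  linarith

theorem two_mul_sum_range_medianCell_le (hw : ∀ j, 0 < w j) :
    2 * ∑ j ∈ Finset.range (medianCell N w), w j ≤ ∑ j ∈ Finset.range N, w j := by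
  rcases Nat.eq_zero_or_pos (medianCell N w) with h | h
  · rw [h]
    simpa using Finset.sum_nonneg fun j _ => (hw j).le
  · obtain ⟨m, hm⟩ := Nat.exists_eq_succ_of_ne_zero h.ne'
    have := Nat.notMem_of_lt_sInf (s := {m | ∑ j ∈ Finset.range N, w j ≤
      2 * ∑ j ∈ Finset.range (m + 1), w j}) (m := m) (by
        change m < medianCell N w
        omega)
    rw [hm]
    exact (not_le.1 this).le

/-- The total weight relative to that of cell `k`. -/
def relWeight (N k : ℕ) (w : ℕ → ℝ) : ℝ := ∑ j ∈ Finset.range N, w j / w k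

theorem one_le_relWeight (hw : ∀ j, 0 < w j) {k : ℕ} (hk : k < N) : 1 ≤ relWeight N k w := by
  rw [← div_self (hw k).ne']
  exact Finset.single_le_sum (f := fun j => w j / w k)
    (fun j _ => (div_pos (hw j) (hw k)).le) (Finset.mem_range.2 hk)

/-- The expected change of the ratio between the weights of the cells `j` and `k` when the
boundary `i` is tested and a positive answer has probability `p`. -/
def meanFactor (k : ℕ) (p : ℝ) (i j : ℕ) : ℝ :=
  p * (factor i true j / factor i true k) + (1 - p) * (factor i false j / factor i false k)

theorem meanFactor_of_same_side {k i j : ℕ} (p : ℝ) (h : j < i ↔ k < i) :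
    meanFactor k p i j = 1 := by
  have h1 : ∀ b, factor i b j = factor i b k := fun b => by simp only [factor, h]
  rw [meanFactor, h1, h1, div_self (factor_pos _ _ _).ne', div_self (factor_pos _ _ _).ne']
  ring

theorem meanFactor_of_left {k i j : ℕ} (p : ℝ) (hj : j < i) (hk : i ≤ k) :
    meanFactor k p i j = p * (10 / 9) + (1 - p) * (19 / 20) := by
  simp only [meanFactor, factor, if_pos hj, if_neg (not_lt.2 hk)]
  norm_num

theorem meanFactor_of_right {k i j : ℕ} (p : ℝ) (hk : k < i) (hj : i ≤ j) :
    meanFactor k p i j = p * (9 / 10) + (1 - p) * (20 / 19) := by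
  simp only [meanFactor, factor, if_pos hk, if_neg (not_lt.2 hj)]
  norm_num

theorem meanFactor_nonneg {k i j : ℕ} {p : ℝ} (hp : 0 ≤ p) (hp1 : p ≤ 1) :
    0 ≤ meanFactor k p i j := by
  have h := fun b => (div_pos (factor_pos i b j) (factor_pos i b k)).le
  exact add_nonneg (mul_nonneg hp (h _)) (mul_nonneg (by linarith) (h _))

/-- Cell `k` is the one where the probability of a positive answer crosses `1 / 3`, so even an
unreliable query increases the ratio by a factor close to one only. -/
theorem meanFactor_le {k i : ℕ} {p : ℝ} (hl : i ≤ k → p ≤ 1 / 3) (hr : k < i → 1 / 3 ≤ p)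
    (j : ℕ) : meanFactor k p i j ≤ 5019 / 5000 := by
  by_cases h : j < i ↔ k < i
  · rw [meanFactor_of_same_side p h]; norm_num
  · rcases lt_or_ge k i with hk | hk
    · rw [meanFactor_of_right p hk (by omega)]
      linarith [hr hk]
    · rw [meanFactor_of_left p (by omega) hk]
      linarith [hl hk]

theorem meanFactor_le_of_le {k i : ℕ} {p : ℝ} (hik : i ≤ k) (hp : p ≤ 1 / 6) (j : ℕ) :
    meanFactor k p i j ≤ 1 ∧ (j < i → meanFactor k p i j ≤ 977 / 1000) := by
  by_cases h : j < i
  · rw [meanFactor_of_left p h hik]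
    constructor
    · linarith
    · intro; linarith
  · rw [meanFactor_of_same_side p (by omega)]
    exact ⟨le_rfl, fun h' => absurd h' h⟩

theorem meanFactor_le_of_lt {k i : ℕ} {p : ℝ} (hik : k < i) (hp : 1 / 2 ≤ p) (j : ℕ) :
    meanFactor k p i j ≤ 1 ∧ (i ≤ j → meanFactor k p i j ≤ 977 / 1000) := by
  by_cases h : i ≤ j
  · rw [meanFactor_of_right p hik h]
    constructor
    · linarith
    · intro; linarith
  · rw [meanFactor_of_same_side p (by omega)]
    exact ⟨le_rfl, fun h' => absurd h' h⟩

/-- The mean over the four pairs of answers of a round, of the relative weight after the round. -/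
theorem mean_relWeight_reweight (hw : ∀ j, 0 < w j) (k i i' : ℕ) (p p' : ℝ) :
    p * (p' * relWeight N k (reweight i' true (reweight i true w)) +
        (1 - p') * relWeight N k (reweight i' false (reweight i true w))) +
      (1 - p) * (p' * relWeight N k (reweight i' true (reweight i false w)) +
        (1 - p') * relWeight N k (reweight i' false (reweight i false w))) =
    ∑ j ∈ Finset.range N, w j / w k * (meanFactor k p i j * meanFactor k p' i' j) := by
  simp only [relWeight, Finset.mul_sum, ← Finset.sum_add_distrib]
  refine Finset.sum_congr rfl fun j _ => ?_
  have h1 := (hw k).ne'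
  have h2 := fun i b => (factor_pos i b k).ne'
  simp only [reweight, meanFactor, mul_div_mul_comm]
  ring

theorem mean_relWeight_le (hw : ∀ j, 0 < w j) {k i i' : ℕ} {p p' : ℝ}
    (hp' : 0 ≤ p') (hp1' : p' ≤ 1) (hl : i ≤ k → p ≤ 1 / 3) (hr : k < i → 1 / 3 ≤ p)
    (hl' : i' ≤ k → p' ≤ 1 / 3) (hr' : k < i' → 1 / 3 ≤ p') :
    ∑ j ∈ Finset.range N, w j / w k * (meanFactor k p i j * meanFactor k p' i' j) ≤
      (5019 / 5000) ^ 2 * relWeight N k w := by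
  rw [relWeight, Finset.mul_sum]
  refine Finset.sum_le_sum fun j _ => ?_
  rw [mul_comm, sq]
  refine mul_le_mul_of_nonneg_right ?_ (div_pos (hw j) (hw k)).le
  exact mul_le_mul (meanFactor_le hl hr j) (meanFactor_le hl' hr' j)
    (meanFactor_nonneg hp' hp1') (by norm_num)

/-- If a set of cells that holds at least half of the weight loses a fixed fraction in the mean,
while the other cells do not gain, then the total weight drops. -/
theorem sum_relative_le_of_half (hw : ∀ j, 0 < w j) {k : ℕ} {S : Finset ℕ}
    (hS : S ⊆ Finset.range N)
    (hhalf : ∑ j ∈ Finset.range N, w j ≤ 2 * ∑ j ∈ S, w j) {e : ℕ → ℝ}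
    (he : ∀ j ∈ Finset.range N, e j ≤ 1) (heS : ∀ j ∈ S, e j ≤ 977 / 1000) :
    ∑ j ∈ Finset.range N, w j / w k * e j ≤ 1977 / 2000 * relWeight N k w := by
  have h1 : ∑ j ∈ Finset.range N, w j / w k * e j ≤
      ∑ j ∈ Finset.range N, w j / w k - 23 / 1000 * ∑ j ∈ S, w j / w k := by
    rw [← Finset.sum_sdiff hS, ← Finset.sum_sdiff hS (f := fun j => w j / w k)]
    have h2 : ∑ j ∈ Finset.range N \ S, w j / w k * e j ≤ ∑ j ∈ Finset.range N \ S, w j / w k :=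
      Finset.sum_le_sum fun j hj => mul_le_of_le_one_right (div_pos (hw j) (hw k)).le
        (he j (Finset.sdiff_subset hj))
    have h3 : ∑ j ∈ S, w j / w k * e j ≤ 977 / 1000 * ∑ j ∈ S, w j / w k := by
      rw [Finset.mul_sum]
      refine Finset.sum_le_sum fun j hj => ?_
      rw [mul_comm]
      exact mul_le_mul_of_nonneg_right (heS j hj) (div_pos (hw j) (hw k)).le
    linarith
  have h4 : ∑ j ∈ Finset.range N, w j / w k ≤ 2 * ∑ j ∈ S, w j / w k := by
    rw [← Finset.sum_div, ← Finset.sum_div, ← mul_div_assoc]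
    exact div_le_div_of_nonneg_right hhalf (hw k).le
  rw [relWeight]
  linarith

variable (D : ProbabilityMeasure ℝ)

theorem expect_ask_Iic {α : Type} {n : ℕ} (s : ℝ) (K : Bool → Protocol α n) (f : α → ENNReal) :
    Protocol.expect D f (.ask (fun _ => Iic s) fun _ b => K b) =
      ENNReal.ofReal ((D : Measure ℝ).real (Iic s)) * Protocol.expect D f (K true) +
      ENNReal.ofReal (1 - (D : Measure ℝ).real (Iic s)) * Protocol.expect D f (K false) := by
  have h : ∀ (x : ℝ) [Decidable (x ∈ Iic s)], Protocol.expect D f (K (decide (x ∈ Iic s))) =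
      (Iic s).indicator (fun _ => Protocol.expect D f (K true)) x +
        (Iic s)ᶜ.indicator (fun _ => Protocol.expect D f (K false)) x := by
    intro x _
    by_cases hx : x ∈ Iic s
    · rw [indicator_of_mem hx, indicator_of_notMem (not_not.2 hx)]
      simp [hx]
    · rw [indicator_of_notMem hx, indicator_of_mem (mem_compl hx)]
      simp [hx]
  rw [Protocol.expect, lintegral_prod]
  · simp only [lintegral_const, measure_univ, mul_one, h]
    rw [lintegral_add_left (measurable_const.indicator measurableSet_Iic),
      lintegral_indicator_const measurableSet_Iic,
      lintegral_indicator_const measurableSet_Iic.compl,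
      ← probReal_compl_eq_one_sub measurableSet_Iic, ofReal_measureReal, ofReal_measureReal,
      mul_comm, mul_comm (Protocol.expect D f (K false))]
  · simp only [h]
    exact ((measurable_const.indicator measurableSet_Iic).add
      (measurable_const.indicator measurableSet_Iic.compl)).comp measurable_fst |>.aemeasurable

variable {D} {g : ℕ → ℝ}

/-- Cell `m` is a useful answer of the search: its right boundary is not far to the left of the
mean, and its left boundary is to the left of all medians. -/
def IsHit (D : ProbabilityMeasure ℝ) (g : ℕ → ℝ) (m : ℕ) : Prop :=
  1 / 6 < (D : Measure ℝ).real (Iic (g (m + 1))) ∧ (D : Measure ℝ).real (Iic (g m)) < 1 / 2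

open Classical in
/-- A hit is worth `1 / q` and a miss `q`, where `q = 1009 / 1000`; the product over all visits is
at least `1` if at least half of the visits are misses. -/
def visitValue (D : ProbabilityMeasure ℝ) (g : ℕ → ℝ) (m : ℕ) : ℝ :=
  if IsHit D g m then (1009 / 1000)⁻¹ else 1009 / 1000

theorem visitValue_pos (m : ℕ) : 0 < visitValue D g m := by
  unfold visitValue
  split_ifs <;> norm_num

/-- The factor by which the expected potential of the search decreases in each round. -/
def searchRate : ℝ := (5019 / 5000) ^ 2 / (1009 / 1000)

theorem searchRate_pos : 0 < searchRate := by unfold searchRate; norm_num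

theorem searchRate_lt_one : searchRate < 1 := by unfold searchRate; norm_num

theorem measureReal_Iic_mono {x y : ℝ} (h : x ≤ y) :
    (D : Measure ℝ).real (Iic x) ≤ (D : Measure ℝ).real (Iic y) :=
  measureReal_mono (Iic_subset_Iic.2 h)

/-- The potential, relative weight times product of visit values, drops by the factor `searchRate` in
the mean. A hit multiplies the relative weight by at most `(5019 / 5000) ^ 2`. At a miss the median
cell and everything on its far side from `k` hold half of the weight and lie on the wrong side of a
reliably answered query. -/
theorem visitValue_mul_mean_le (hg : Monotone g) {k : ℕ} (hk : k < N)
    (hkl : (D : Measure ℝ).real (Iic (g k)) ≤ 1 / 3)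
    (hkr : 1 / 3 < (D : Measure ℝ).real (Iic (g (k + 1)))) (hw : ∀ j, 0 < w j) :
    visitValue D g (medianCell N w) * ∑ j ∈ Finset.range N, w j / w k *
      (meanFactor k ((D : Measure ℝ).real (Iic (g (medianCell N w)))) (medianCell N w) j *
        meanFactor k ((D : Measure ℝ).real (Iic (g (medianCell N w + 1))))
          (medianCell N w + 1) j) ≤ searchRate * relWeight N k w := by
  set m := medianCell N w with hm
  have hF0 : ∀ x, 0 ≤ (D : Measure ℝ).real (Iic x) := fun x => measureReal_nonneg
  have hF1 : ∀ x, (D : Measure ℝ).real (Iic x) ≤ 1 := fun x => measureReal_le_one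
  have hl : ∀ i, i ≤ k → (D : Measure ℝ).real (Iic (g i)) ≤ 1 / 3 :=
    fun i hi => (measureReal_Iic_mono (hg hi)).trans hkl
  have hr : ∀ i, k < i → 1 / 3 ≤ (D : Measure ℝ).real (Iic (g i)) :=
    fun i hi => hkr.le.trans (measureReal_Iic_mono (hg hi))
  have hR : 0 < relWeight N k w := by linarith [one_le_relWeight hw hk]
  have hm1 : m < N := medianCell_lt hw (by omega)
  unfold visitValue
  split_ifs with hhit
  · have := mean_relWeight_le (N := N) hw (hF0 (g (m + 1)))
      (hF1 (g (m + 1))) (hl m) (hr m) (hl (m + 1)) (hr (m + 1))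
    rw [searchRate, div_mul_eq_mul_div, inv_mul_eq_div]
    exact div_le_div_of_nonneg_right this (by norm_num)
  · suffices h : ∑ j ∈ Finset.range N, w j / w k *
        (meanFactor k ((D : Measure ℝ).real (Iic (g m))) m j *
          meanFactor k ((D : Measure ℝ).real (Iic (g (m + 1)))) (m + 1) j) ≤
        1977 / 2000 * relWeight N k w by
      rw [searchRate]
      nlinarith
    have hcase : (D : Measure ℝ).real (Iic (g (m + 1))) ≤ 1 / 6 ∨
        1 / 2 ≤ (D : Measure ℝ).real (Iic (g m)) := by
      by_contra! h
      exact hhit h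
    have hmono := measureReal_Iic_mono (D := D) (hg (Nat.le_succ m))
    rcases hcase with h | h
    · have hmk : m + 1 ≤ k := by
        by_contra! h'
        linarith [hr (m + 1) (by omega)]
      have e1 := meanFactor_le_of_le (p := (D : Measure ℝ).real (Iic (g m))) (i := m) (k := k)
        (by omega) (hmono.trans h)
      have e2 := meanFactor_le_of_le (p := (D : Measure ℝ).real (Iic (g (m + 1)))) hmk h
      refine sum_relative_le_of_half hw (S := Finset.range (m + 1))
        (Finset.range_subset_range.2 hm1) (medianCell_spec hw) (fun j _ => ?_) (fun j hj => ?_)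
      · exact mul_le_one₀ (e1 j).1 (meanFactor_nonneg (hF0 _) (hF1 _)) (e2 j).1
      · rw [← one_mul (977 / 1000 : ℝ)]
        exact mul_le_mul (e1 j).1 ((e2 j).2 (Finset.mem_range.1 hj))
          (meanFactor_nonneg (hF0 _) (hF1 _)) zero_le_one
    · have hmk : k < m := by
        by_contra! h'
        linarith [hl m h']
      have e1 := meanFactor_le_of_lt (p := (D : Measure ℝ).real (Iic (g m))) hmk h
      have e2 := meanFactor_le_of_lt (p := (D : Measure ℝ).real (Iic (g (m + 1)))) (k := k)
        (i := m + 1) (by omega) (h.trans hmono)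
      refine sum_relative_le_of_half hw (S := Finset.range N \ Finset.range m)
        Finset.sdiff_subset ?_ (fun j _ => ?_) (fun j hj => ?_)
      · have h1 := two_mul_sum_range_medianCell_le (N := N) hw
        have h2 := Finset.sum_sdiff (f := w) (Finset.range_subset_range.2 hm1.le)
        linarith
      · exact mul_le_one₀ (e1 j).1 (meanFactor_nonneg (hF0 _) (hF1 _)) (e2 j).1
      · rw [← mul_one (977 / 1000 : ℝ)]
        refine mul_le_mul ((e1 j).2 ?_) (e2 j).1 (meanFactor_nonneg (hF0 _) (hF1 _)) (by norm_num)
        simp only [Finset.mem_sdiff, Finset.mem_range] at hj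
        omega

/-- The relative weight is at least one at the end, so it can be dropped from the potential. -/
theorem expect_search_le (hg : Monotone g) {k : ℕ} (hk : k < N)
    (hkl : (D : Measure ℝ).real (Iic (g k)) ≤ 1 / 3)
    (hkr : 1 / 3 < (D : Measure ℝ).real (Iic (g (k + 1)))) (n : ℕ) :
    ∀ w : ℕ → ℝ, (∀ j, 0 < w j) →
      Protocol.expect D (fun l => ENNReal.ofReal (l.map (visitValue D g)).prod) (search g N n w) ≤
        ENNReal.ofReal (searchRate ^ n * relWeight N k w) := by
  induction n with
  | zero =>
    intro w hw
    simp only [search, Protocol.expect, List.map_nil, List.prod_nil, pow_zero, one_mul]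
    exact ENNReal.ofReal_le_ofReal (one_le_relWeight hw hk)
  | succ n ih =>
    intro w hw
    set m := medianCell N w with hm
    set p := (D : Measure ℝ).real (Iic (g m)) with hp
    set p' := (D : Measure ℝ).real (Iic (g (m + 1))) with hp'
    have hp0 : 0 ≤ p := measureReal_nonneg
    have hp1 : 0 ≤ 1 - p := sub_nonneg.2 measureReal_le_one
    have hp0' : 0 ≤ p' := measureReal_nonneg
    have hp1' : 0 ≤ 1 - p' := sub_nonneg.2 measureReal_le_one
    have hv := visitValue_pos (D := D) (g := g) m
    have hr := pow_pos searchRate_pos n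
    set R : Bool → Bool → ℝ := fun b b' =>
      relWeight N k (reweight (m + 1) b' (reweight m b w)) with hR
    have hR0 : ∀ b b', 0 ≤ R b b' := fun b b' =>
      zero_le_one.trans (one_le_relWeight (reweight_pos (reweight_pos hw _ _) _ _) hk)
    have key : ∀ b b', Protocol.expect D (fun l => ENNReal.ofReal (l.map (visitValue D g)).prod)
        ((search g N n (reweight (m + 1) b' (reweight m b w))).map fun l => m :: l) ≤
        ENNReal.ofReal (visitValue D g m * (searchRate ^ n * R b b')) := by
      intro b b'
      rw [Protocol.expect_map]
      simp only [List.map_cons, List.prod_cons, ENNReal.ofReal_mul hv.le]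
      rw [Protocol.expect_const_mul D _ ENNReal.ofReal_ne_top]
      have := ih _ (reweight_pos (reweight_pos hw m b) (m + 1) b')
      rw [hR]
      gcongr
    have hprod : ∀ b b', 0 ≤ visitValue D g m * (searchRate ^ n * R b b') := fun b b' => by
      have := hR0 b b'
      positivity
    have hinner : ∀ b, Protocol.expect D
        (fun l => ENNReal.ofReal (l.map (visitValue D g)).prod)
        (.ask (fun _ => Iic (g (m + 1))) fun _ b' =>
          (search g N n (reweight (m + 1) b' (reweight m b w))).map fun l => m :: l) ≤
        ENNReal.ofReal (p' * (visitValue D g m * (searchRate ^ n * R b true)) +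
          (1 - p') * (visitValue D g m * (searchRate ^ n * R b false))) := by
      intro b
      rw [expect_ask_Iic D (g (m + 1)) (fun b' =>
          (search g N n (reweight (m + 1) b' (reweight m b w))).map fun l => m :: l),
        ENNReal.ofReal_add (mul_nonneg hp0' (hprod _ _)) (mul_nonneg hp1' (hprod _ _)),
        ENNReal.ofReal_mul hp0', ENNReal.ofReal_mul hp1']
      exact add_le_add (mul_le_mul_right (key _ _) _) (mul_le_mul_right (key _ _) _)
    have hsum : ∀ b, 0 ≤ p' * (visitValue D g m * (searchRate ^ n * R b true)) +
          (1 - p') * (visitValue D g m * (searchRate ^ n * R b false)) := fun b =>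
      add_nonneg (mul_nonneg hp0' (hprod _ _)) (mul_nonneg hp1' (hprod _ _))
    have houter := expect_ask_Iic D (g m) (fun b =>
      .ask (fun _ => Iic (g (m + 1))) fun _ b' =>
        (search g N n (reweight (m + 1) b' (reweight m b w))).map fun l => m :: l)
      (fun l => ENNReal.ofReal (l.map (visitValue D g)).prod)
    refine houter.le.trans ((add_le_add (mul_le_mul_right (hinner true) _)
      (mul_le_mul_right (hinner false) _)).trans ?_)
    rw [← ENNReal.ofReal_mul hp0, ← ENNReal.ofReal_mul hp1,
      ← ENNReal.ofReal_add (mul_nonneg hp0 (hsum _)) (mul_nonneg hp1 (hsum _))]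
    refine ENNReal.ofReal_le_ofReal ?_
    have h1 := visitValue_mul_mean_le hg hk hkl hkr hw
    rw [← hm, ← hp, ← hp', ← mean_relWeight_reweight hw] at h1
    have h2 := mul_le_mul_of_nonneg_left h1 hr.le
    rw [pow_succ]
    simp only [hR]
    linarith

end Search

/-! ### The localizer -/

section Localization

theorem exists_isHit_of_countP {D : ProbabilityMeasure ℝ} {g : ℕ → ℝ} {l : List ℕ} {P : ℕ → Bool}
    (hP : l.length ≤ 2 * l.countP P)
    (hl : 2 * l.countP (open Classical in fun m => decide (¬ IsHit D g m)) < l.length) :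
    ∃ m ∈ l, P m ∧ IsHit D g m := by
  classical
  by_contra! h
  have := List.countP_mono_left (l := l) (p := P) (q := fun m => decide (¬ IsHit D g m))
    fun m hm hPm => by simpa using h m hm hPm
  have h2 : l.countP (fun m => decide (¬ IsHit D g m)) =
      l.countP (open Classical in fun m => decide (¬ IsHit D g m)) := by
    congr
  omega

theorem medianVisit_spec (l : List ℕ) : l.length ≤ 2 * l.countP (· ≤ medianVisit l) := by
  refine Nat.sInf_mem (s := {i | l.length ≤ 2 * l.countP (· ≤ i)}) ⟨l.sum, ?_⟩
  have : l.countP (· ≤ l.sum) = l.length := by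
    rw [List.countP_eq_length]
    intro a ha
    simpa using List.single_le_sum (by simp) a ha
  simp only [mem_ofPred_eq, this]
  omega

theorem two_mul_countP_lt_medianVisit {l : List ℕ} :
    2 * l.countP (· < medianVisit l) ≤ l.length := by
  rcases Nat.eq_zero_or_pos (medianVisit l) with h | h
  · rw [h]
    simp
  · obtain ⟨m, hm⟩ := Nat.exists_eq_succ_of_ne_zero h.ne'
    have := Nat.notMem_of_lt_sInf (s := {i | l.length ≤ 2 * l.countP (· ≤ i)}) (m := m) (by
        change m < medianVisit l
        omega)
    rw [hm]
    simp only [Nat.succ_eq_add_one, Nat.lt_succ_iff]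
    exact (not_le.1 this).le

/-- The median of the visits is a hit as soon as most of the visits are, because the two
conditions that define a hit are monotone in the cell. -/
theorem isHit_medianVisit {D : ProbabilityMeasure ℝ} {g : ℕ → ℝ} (hg : Monotone g) {l : List ℕ}
    (hl : 2 * l.countP (open Classical in fun m => decide (¬ IsHit D g m)) < l.length) :
    IsHit D g (medianVisit l) := by
  obtain ⟨m, -, hm, hit⟩ := exists_isHit_of_countP (medianVisit_spec l) hl
  have hge : l.length ≤ 2 * l.countP (fun m => decide (medianVisit l ≤ m)) := by
    have h1 := two_mul_countP_lt_medianVisit (l := l)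
    have h2 := List.length_eq_countP_add_countP (fun m => decide (m < medianVisit l)) (l := l)
    have h3 : l.countP (fun a => decide ¬ decide (a < medianVisit l) = true) =
        l.countP (fun m => decide (medianVisit l ≤ m)) := by
      congr 1
      funext a
      simp
    omega
  obtain ⟨m', -, hm', hit'⟩ := exists_isHit_of_countP hge hl
  simp only [decide_eq_true_eq] at hm hm'
  exact ⟨hit.1.trans_le (measureReal_Iic_mono (hg (by omega))),
    (measureReal_Iic_mono (hg hm')).trans_lt hit'.2⟩

theorem prod_visitValue (D : ProbabilityMeasure ℝ) (g : ℕ → ℝ) (l : List ℕ) :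
    (l.map (visitValue D g)).prod = (1009 / 1000 : ℝ) ^
      (2 * (l.countP (open Classical in fun m => decide (¬ IsHit D g m)) : ℤ) - l.length) := by
  classical
  induction l with
  | nil => simp
  | cons m l ih =>
    rw [List.map_cons, List.prod_cons, ih, visitValue]
    by_cases h : IsHit D g m
    · rw [if_pos h, List.countP_cons_of_neg (by simpa using h), ← zpow_neg_one,
        ← zpow_add₀ (by norm_num)]
      congr 1
      push_cast [List.length_cons]
      ring
    · rw [if_neg h, List.countP_cons_of_pos (by simpa using h)]
      nth_rw 1 [← zpow_one (1009 / 1000 : ℝ)]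
      rw [← zpow_add₀ (by norm_num)]
      congr 1
      push_cast [List.length_cons]
      ring

/-- Markov's inequality for the product of the visit values. -/
theorem pr_search_le {D : ProbabilityMeasure ℝ} {g : ℕ → ℝ} (hg : Monotone g) {N k : ℕ}
    (hk : k < N) (hkl : (D : Measure ℝ).real (Iic (g k)) ≤ 1 / 3)
    (hkr : 1 / 3 < (D : Measure ℝ).real (Iic (g (k + 1)))) (n : ℕ) :
    Protocol.pr D (search g N n fun _ => 1) {l | ¬ IsHit D g (medianVisit l)} ≤
      ENNReal.ofReal (searchRate ^ n * N) := by
  have h1 := expect_search_le hg hk hkl hkr n (fun _ => 1) fun _ => one_pos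
  have h2 : relWeight N k (fun _ => 1) = N := by simp [relWeight]
  rw [h2] at h1
  refine le_trans (Protocol.expect_mono D (fun l => ?_) _) h1
  by_cases hl : IsHit D g (medianVisit l)
  · rw [indicator_of_notMem (by simpa using hl)]
    exact zero_le
  · rw [indicator_of_mem (by exact hl), Pi.one_apply, prod_visitValue]
    rw [← ENNReal.ofReal_one]
    refine ENNReal.ofReal_le_ofReal (one_le_zpow₀ (by norm_num) ?_)
    by_contra! h
    exact hl (isHit_medianVisit hg (by omega))

theorem measurable_run_search {β : Type} [MeasurableSpace β] (g : ℕ → ℝ) (N n : ℕ) :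
    ∀ (w : ℕ → ℝ) (f : List ℕ → β), Measurable fun ω => f ((search g N n w).run ω) := by
  have hask : ∀ {n : ℕ} (s : ℝ) (K : Bool → Protocol (List ℕ) n) (f : List ℕ → β),
      (∀ b, Measurable fun ω => f ((K b).run ω)) →
      Measurable fun ω => f ((Protocol.ask (fun _ => Iic s) fun _ b => K b).run ω) := by
    classical
    intro n s K f h
    have e : (fun ω => f ((Protocol.ask (fun _ => Iic s) fun _ b => K b).run ω)) =
        fun ω : Fin (n + 1) → ℝ × unitInterval => if (ω 0).1 ∈ Iic s
          then f ((K true).run (Fin.tail ω)) else f ((K false).run (Fin.tail ω)) := by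
      funext ω
      by_cases hω : (ω 0).1 ∈ Iic s
      · simp only [Protocol.run, hω, decide_true, if_true]
      · simp only [Protocol.run, hω, decide_false, if_false]
    have ht : Measurable (Fin.tail : (Fin (n + 1) → ℝ × unitInterval) → _) :=
      measurable_pi_lambda _ fun i => measurable_pi_apply _
    rw [e]
    exact Measurable.ite (measurableSet_Iic.preimage (by fun_prop)) ((h true).comp ht)
      ((h false).comp ht)
  induction n with
  | zero =>
    intro w f
    exact (measurable_const : Measurable fun _ : Fin 0 → ℝ × unitInterval => f [])
  | succ n ih =>
    intro w f
    refine hask _ (fun b => .ask (fun _ => Iic (g (medianCell N w + 1))) fun _ b' =>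
      (search g N n (reweight (medianCell N w + 1) b' (reweight (medianCell N w) b w))).map
          fun l => medianCell N w :: l) f fun b => ?_
    refine hask _ (fun b' =>
      (search g N n (reweight (medianCell N w + 1) b' (reweight (medianCell N w) b w))).map
          fun l => medianCell N w :: l) f fun b' => ?_
    simp only [Protocol.run_map]
    exact ih _ fun l => f (medianCell N w :: l)

theorem Protocol.UsesOnly.map {α β : Type} {𝒬 : Set (Set ℝ)} (f : α → β) {n : ℕ}
    {p : Protocol α n} (hp : p.UsesOnly 𝒬) : (p.map f).UsesOnly 𝒬 := by
  induction p with
  | done a => trivial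
  | ask Q k ih => exact ⟨hp.1, fun u b => ih u b (hp.2 u b)⟩

theorem usesOnly_search (g : ℕ → ℝ) (N n : ℕ) :
    ∀ w : ℕ → ℝ, (search g N n w).UsesOnly (range Iic) := by
  induction n with
  | zero => intro w; trivial
  | succ n ih =>
    intro w
    exact ⟨fun _ => mem_range_self _, fun _ _ => ⟨fun _ => mem_range_self _,
      fun _ _ => Protocol.UsesOnly.map _ (ih _)⟩⟩

/-- The boundaries of the cells: a grid of step `σ / 2` that starts to the left of `-lam`. -/
def boundary (lam σ : ℝ) (i : ℕ) : ℝ := -lam - 3 * σ + i * (σ / 2)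

/-- The number of cells, large enough for the grid to extend beyond `lam + 2 * σ`. -/
def numCells (lam σ : ℝ) : ℕ := ⌈4 * (lam / σ)⌉₊ + 10

/-- The number of rounds of the search. -/
def numRounds (lam σ δ : ℝ) : ℕ :=
  ⌈(Real.log (numCells lam σ) + Real.log (1 / δ)) / -Real.log searchRate⌉₊

/-- The localizer: the interval of length `4 σ` to the right of the cell found by the search. -/
def searchLocalizer : Localizer where
  size lam σ δ := 2 * numRounds lam σ δ
  protocol lam σ δ :=
    (search (boundary lam σ) (numCells lam σ) (numRounds lam σ δ) fun _ => 1).map fun l =>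
      (boundary lam σ (medianVisit l), boundary lam σ (medianVisit l) + 4 * σ)

variable {lam σ δ : ℝ}

theorem boundary_monotone (hσ : 0 < σ) : Monotone (boundary lam σ) := by
  intro i j h
  have : (i : ℝ) ≤ j := by exact_mod_cast h
  unfold boundary
  nlinarith

theorem searchRate_pow_mul_le (hδ : 0 < δ) :
    searchRate ^ numRounds lam σ δ * numCells lam σ ≤ δ := by
  have hr : 0 < -Real.log searchRate :=
    neg_pos.2 (Real.log_neg searchRate_pos searchRate_lt_one)
  have hN : (0 : ℝ) < numCells lam σ := by
    exact_mod_cast (by unfold numCells; omega : 0 < numCells lam σ)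
  have h1 := Nat.le_ceil ((Real.log (numCells lam σ) + Real.log (1 / δ)) / -Real.log searchRate)
  rw [div_le_iff₀ hr, one_div, Real.log_inv] at h1
  rw [← Real.log_le_log_iff (by have := searchRate_pos; positivity) hδ,
    Real.log_mul (pow_pos searchRate_pos _).ne' hN.ne', Real.log_pow]
  unfold numRounds
  rw [one_div, Real.log_inv]
  linarith

theorem localizer_size_le :
    ∃ C : ℝ, 0 ≤ C ∧ ∀ lam σ δ : ℝ, 0 < lam → 0 < σ → 0 < δ → δ < 1 →
      (searchLocalizer.size lam σ δ : ℝ) ≤ C * (logp (lam / σ) + logp (1 / δ)) := by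
  have hr : 0 < -Real.log searchRate :=
    neg_pos.2 (Real.log_neg searchRate_pos searchRate_lt_one)
  refine ⟨2 * (4 / -Real.log searchRate + 1), by positivity, fun lam σ δ hlam hσ hδ hδ1 => ?_⟩
  have hx : 0 < lam / σ := by positivity
  set x := lam / σ with hxdef
  have h1 : 1 ≤ logp x := le_max_left _ _
  have h2 : Real.log x ≤ logp x := le_max_right _ _
  have h1' : 1 ≤ logp (1 / δ) := le_max_left _ _
  have h2' : Real.log (1 / δ) ≤ logp (1 / δ) := le_max_right _ _
  have hlog16 : Real.log 15 ≤ 3 := by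
    rw [Real.log_le_iff_le_exp (by norm_num)]
    have h27 := Real.exp_one_gt_d9
    calc (15 : ℝ) ≤ 2.7 ^ 3 := by norm_num
      _ ≤ Real.exp 1 ^ 3 := by gcongr; linarith
      _ = Real.exp 3 := by rw [← Real.exp_nat_mul]; norm_num
  have hN : (numCells lam σ : ℝ) ≤ 15 * max 1 x := by
    have h3 := (Nat.ceil_lt_add_one (show 0 ≤ 4 * x by positivity)).le
    have h4 := le_max_left 1 x
    have h5 := le_max_right 1 x
    rw [numCells]
    push_cast
    linarith
  have hN0 : (0 : ℝ) < numCells lam σ := by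
    exact_mod_cast (by unfold numCells; omega : 0 < numCells lam σ)
  have hmax : Real.log (max 1 x) ≤ logp x := by
    rcases le_total 1 x with h | h
    · rwa [max_eq_right h]
    · rw [max_eq_left h, Real.log_one]; linarith
  have hlogN : Real.log (numCells lam σ) ≤ 3 + logp x := by
    refine (Real.log_le_log hN0 hN).trans ?_
    rw [Real.log_mul (by norm_num) (by positivity)]
    linarith
  have hnum : 0 ≤ Real.log (numCells lam σ) + Real.log (1 / δ) := by
    refine add_nonneg (Real.log_nonneg ?_) (Real.log_nonneg ?_)
    · exact_mod_cast (by unfold numCells; omega : 1 ≤ numCells lam σ)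
    · rw [le_div_iff₀ hδ]; linarith
  have h6 := (Nat.ceil_lt_add_one (div_nonneg hnum hr.le)).le
  have h7 : (Real.log (numCells lam σ) + Real.log (1 / δ)) / -Real.log searchRate ≤
      4 / -Real.log searchRate * (logp x + logp (1 / δ)) := by
    rw [div_mul_eq_mul_div]
    exact div_le_div_of_nonneg_right (by linarith) hr.le
  simp only [searchLocalizer, numRounds]
  push_cast
  linarith

/-- With Chebyshev's inequality at `5 / 2` standard deviations, a hit lies within `3 σ` of the
mean, on the left of all medians. -/
theorem IsHit.localizes {D : ProbabilityMeasure ℝ} (hσ : 0 < σ) (hD : D ∈ family lam σ) {j : ℕ}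
    (hj : IsHit D (boundary lam σ) j) :
    (∀ M, IsMedian D M → boundary lam σ j ≤ M ∧ M ≤ boundary lam σ j + 4 * σ) := by
  intro M hM
  have hM1 := abs_le.1 (hM.abs_sub_mean_le hσ hD)
  have hM2 := (isMedian_iff.1 hM).1
  constructor
  · by_contra! h
    have := measureReal_Iic_mono (D := D) h.le
    linarith [hj.2]
  · have hb : boundary lam σ (j + 1) = boundary lam σ j + σ / 2 := by
      unfold boundary
      push_cast
      ring
    have h1 : mean D - 5 / 2 * σ < boundary lam σ (j + 1) := by
      by_contra! h
      have := chebyshev_of_subset hσ hD (a := 5 / 2) (by norm_num)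
        (A := Iic (boundary lam σ (j + 1))) fun x hx => by
          rw [abs_sub_comm]
          exact le_trans (by linarith [mem_Iic.1 hx]) (le_abs_self _)
      have := hj.1
      norm_num at *
      linarith
    linarith

theorem exists_target_cell {D : ProbabilityMeasure ℝ} (hlam : 0 < lam) (hσ : 0 < σ)
    (hD : D ∈ family lam σ) :
    ∃ k < numCells lam σ, (D : Measure ℝ).real (Iic (boundary lam σ k)) ≤ 1 / 3 ∧
      1 / 3 < (D : Measure ℝ).real (Iic (boundary lam σ (k + 1))) := by
  classical
  have hmean := abs_le.1 hD.2.1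
  have h0 : (D : Measure ℝ).real (Iic (boundary lam σ 0)) ≤ 1 / 3 := by
    refine (chebyshev_of_subset hσ hD (a := 3) (by norm_num) fun x hx => ?_).trans (by norm_num)
    rw [abs_sub_comm]
    refine le_trans ?_ (le_abs_self _)
    have hx' : x ≤ -lam - 3 * σ + (0 : ℕ) * (σ / 2) := hx
    push_cast at hx'
    linarith
  have hN : 1 / 3 < (D : Measure ℝ).real (Iic (boundary lam σ (numCells lam σ))) := by
    have h1 : (D : Measure ℝ).real (Iic (boundary lam σ (numCells lam σ)))ᶜ ≤ 1 / 2 ^ 2 := by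
      refine chebyshev_of_subset hσ hD (by norm_num) fun x hx => ?_
      refine le_trans ?_ (le_abs_self _)
      have hx' : boundary lam σ (numCells lam σ) < x := not_le.1 hx
      have h2 := Nat.le_ceil (4 * (lam / σ))
      have h3 : 2 * lam + 5 * σ ≤ numCells lam σ * (σ / 2) := by
        rw [numCells]
        push_cast
        have : 4 * (lam / σ) * (σ / 2) = 2 * lam := by field_simp; norm_num
        nlinarith
      unfold boundary at hx'
      linarith
    rw [probReal_compl_eq_one_sub measurableSet_Iic] at h1
    rw [show (1 : ℝ) / 2 ^ 2 = 1 / 4 by norm_num] at h1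
    linarith
  have hex : ∃ i, 1 / 3 < (D : Measure ℝ).real (Iic (boundary lam σ i)) := ⟨_, hN⟩
  have hpos : Nat.find hex ≠ 0 := by
    intro h
    have := Nat.find_spec hex
    rw [h] at this
    linarith
  obtain ⟨k, hk⟩ := Nat.exists_eq_succ_of_ne_zero hpos
  refine ⟨k, ?_, not_lt.1 (Nat.find_min hex (by omega)), ?_⟩
  · have := Nat.find_min' hex hN
    omega
  · have := Nat.find_spec hex
    rwa [hk] at this

theorem isMedianLocalizer_searchLocalizer :
    ∃ C : ℝ, searchLocalizer.IsMedianLocalizer C := by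
  obtain ⟨C, -, hC⟩ := localizer_size_le
  refine ⟨C, fun lam σ δ hlam hσ hδ hδ1 => ?_⟩
  have hm : Measurable (searchLocalizer.protocol lam σ δ).run := by
    have : (searchLocalizer.protocol lam σ δ).run = fun ω =>
        (fun l => (boundary lam σ (medianVisit l), boundary lam σ (medianVisit l) + 4 * σ))
          ((search (boundary lam σ) (numCells lam σ) (numRounds lam σ δ) fun _ => 1).run ω) := by
      funext ω
      exact Protocol.run_map _ _ _
    rw [this]
    exact measurable_run_search (boundary lam σ) _ _ _
      fun l => (boundary lam σ (medianVisit l), boundary lam σ (medianVisit l) + 4 * σ)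
  refine ⟨Protocol.UsesOnly.map _ (usesOnly_search _ _ _ _), hm, hC lam σ δ hlam hσ hδ hδ1,
    fun D hD => Protocol.prob_ge_of_pr_compl_le D hm (measurableSet_localized D σ) hδ.le ?_⟩
  obtain ⟨k, hkN, hkl, hkr⟩ := exists_target_cell hlam hσ hD
  refine (Protocol.pr_map D _ _ _).le.trans (le_trans (Protocol.pr_mono D ?_ _)
    ((pr_search_le (boundary_monotone hσ) hkN hkl hkr _).trans
      (ENNReal.ofReal_le_ofReal (searchRate_pow_mul_le hδ))))
  intro l hl hit
  exact hl ⟨IsHit.localizes hσ hD hit, by dsimp only; linarith⟩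

end Localization

/-! ### Correctness of the adaptive estimator -/

section Adaptive

variable {r δ lam σmin σmax : ℝ}

theorem confInt_inter_nonempty_iff {v : ℕ → ℝ} {i j : ℕ} :
    (confInt r σmin v i ∩ confInt r σmin v j).Nonempty ↔
      (v i - gridε r σmin i ≤ v i + gridε r σmin i ∧ v j - gridε r σmin j ≤ v i + gridε r σmin i) ∧
      (v i - gridε r σmin i ≤ v j + gridε r σmin j ∧
        v j - gridε r σmin j ≤ v j + gridε r σmin j) := by
  rw [confInt, confInt, Icc_inter_Icc, nonempty_Icc, sup_le_iff, le_inf_iff, le_inf_iff]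
  tauto

theorem measurableSet_feasible (T i : ℕ) : MeasurableSet {v | Feasible r σmin T v i} := by
  have : {v | Feasible r σmin T v i} = {v | i ≤ T} ∩
      ⋂ j : ℕ, {v | i < j → j ≤ T → (confInt r σmin v i ∩ confInt r σmin v j).Nonempty} := by
    ext v
    simp [Feasible]
  rw [this]
  refine (MeasurableSet.const _).inter (MeasurableSet.iInter fun j => ?_)
  refine MeasurableSet.imp (MeasurableSet.const _) (MeasurableSet.imp (MeasurableSet.const _) ?_)
  have hle : ∀ i j : ℕ, MeasurableSet
      {v : ℕ → ℝ | v i - gridε r σmin i ≤ v j + gridε r σmin j} := fun i j =>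
    measurableSet_le (by fun_prop) (by fun_prop)
  have e : {v | (confInt r σmin v i ∩ confInt r σmin v j).Nonempty} =
      ({v | v i - gridε r σmin i ≤ v i + gridε r σmin i} ∩
        {v | v j - gridε r σmin j ≤ v i + gridε r σmin i}) ∩
      ({v | v i - gridε r σmin i ≤ v j + gridε r σmin j} ∩
        {v | v j - gridε r σmin j ≤ v j + gridε r σmin j}) :=
    Set.ext fun v => confInt_inter_nonempty_iff
  rw [e]
  exact ((hle _ _).inter (hle _ _)).inter ((hle _ _).inter (hle _ _))

theorem feasible_last (v : ℕ → ℝ) (T : ℕ) : Feasible r σmin T v T :=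
  ⟨le_rfl, fun _ h1 h2 => absurd h1 (not_lt.2 h2)⟩

theorem measurable_apply_iStar (T : ℕ) :
    Measurable fun v : ℕ → ℝ => v (iStar r σmin T v) := by
  classical
  have h1 : Measurable fun v : ℕ → ℝ => iStar r σmin T v := by
    have hex : ∀ v : ℕ → ℝ, ∃ i, Feasible r σmin T v i := fun v => ⟨T, feasible_last v T⟩
    have : (fun v : ℕ → ℝ => iStar r σmin T v) = fun v => Nat.find (hex v) := by
      funext v
      exact Nat.sInf_def (hex v)
    rw [this]
    exact measurable_find hex fun k => measurableSet_feasible T k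
  exact (measurable_from_prod_countable_right (f := fun x : ℕ × (ℕ → ℝ) => x.2 x.1)
    fun i => measurable_pi_apply i).comp (h1.prodMk measurable_id)

theorem gridσ_pos (h : 0 < σmin) (i : ℕ) : 0 < gridσ σmin i := by
  unfold gridσ
  positivity

theorem gridσ_mono (h : 0 < σmin) {i j : ℕ} (hij : i ≤ j) : gridσ σmin i ≤ gridσ σmin j := by
  unfold gridσ
  gcongr
  norm_num

theorem le_gridσ_gridT (h : 0 < σmin) (h' : 0 < σmax) :
    σmax ≤ gridσ σmin (gridT σmin σmax) := by
  have h1 := Nat.le_ceil (Real.logb 2 (σmax / σmin))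
  rw [Real.logb_le_iff_le_rpow (by norm_num) (by positivity), Real.rpow_natCast,
    div_le_iff₀ h] at h1
  rw [gridσ, mul_comm]
  exact h1

theorem gridε_pos (hr : 0 < r) (h : 0 < σmin) (i : ℕ) : 0 < gridε r σmin i := by
  have := gridσ_pos h i
  unfold gridε
  positivity

/-- The Lepski argument: once the estimates at all grid points above the true standard deviation
are accurate, the first of these grid points is feasible, and the smallest feasible index yields an
estimate that is consistent with it. -/
theorem abs_apply_iStar_sub_le (hr : 0 < r) (hmin : 0 < σmin) {T i₀ : ℕ} (hi₀ : i₀ ≤ T)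
    {v : ℕ → ℝ} {μ s : ℝ} (hs : gridσ σmin i₀ ≤ 2 * s)
    (hv : ∀ i, i₀ ≤ i → i ≤ T → |v i - μ| ≤ gridε r σmin i) :
    |v (iStar r σmin T v) - μ| ≤ r * s := by
  have hfeas : Feasible r σmin T v i₀ := by
    refine ⟨hi₀, fun j hij hj => ⟨μ, ?_, ?_⟩⟩
    · have := abs_le.1 (hv i₀ le_rfl hi₀)
      exact ⟨by linarith, by linarith⟩
    · have := abs_le.1 (hv j hij.le hj)
      exact ⟨by linarith, by linarith⟩
  have hle : iStar r σmin T v ≤ i₀ := Nat.sInf_le hfeas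
  have hstar : Feasible r σmin T v (iStar r σmin T v) :=
    Nat.sInf_mem (s := {i | Feasible r σmin T v i}) ⟨_, hfeas⟩
  have h0 := abs_le.1 (hv i₀ le_rfl hi₀)
  have hε : gridε r σmin i₀ ≤ 2 / 5 * (r * s) := by
    unfold gridε
    nlinarith
  rcases hle.lt_or_eq with hlt | heq
  · obtain ⟨x, hx1, hx2⟩ := hstar.2 i₀ hlt hi₀
    -- The grid is dyadic, so the total error is at most `(1 / 2 + 2) * gridε i₀ ≤ r * s`.
    have hhalf : gridε r σmin (iStar r σmin T v) ≤ gridε r σmin i₀ / 2 := by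
      have h1 := gridσ_mono hmin (Nat.succ_le_of_lt hlt)
      unfold gridσ at h1
      rw [Nat.succ_eq_add_one, pow_succ] at h1
      unfold gridε gridσ
      nlinarith
    rw [confInt, mem_Icc] at hx1 hx2
    exact abs_le.2 ⟨by linarith, by linarith⟩
  · rw [heq]
    have := gridε_pos hr hmin i₀
    exact abs_le.2 ⟨by linarith, by linarith⟩

theorem exists_grid_index (hmin : 0 < σmin) (hmm : σmin ≤ σmax) {s : ℝ}
    (hs : s ∈ Icc σmin σmax) :
    ∃ i ≤ gridT σmin σmax, s ≤ gridσ σmin i ∧ gridσ σmin i ≤ 2 * s := by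
  classical
  have hT := hs.2.trans (le_gridσ_gridT hmin (hmin.trans_le hmm))
  have hex : ∃ i, s ≤ gridσ σmin i := ⟨_, hT⟩
  refine ⟨Nat.find hex, Nat.find_min' hex hT, Nat.find_spec hex, ?_⟩
  rcases Nat.eq_zero_or_pos (Nat.find hex) with h | h
  · rw [h, gridσ, pow_zero, mul_one]
    linarith [hs.1]
  · obtain ⟨k, hk⟩ := Nat.exists_eq_succ_of_ne_zero h.ne'
    have h1 := not_le.1 (Nat.find_min hex (m := k) (by omega))
    rw [hk, Nat.succ_eq_add_one]
    unfold gridσ at h1 ⊢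
    rw [pow_succ]
    linarith

variable {loc : Localizer} {C : ℝ}

theorem isPAC_adaptiveEstimator (hloc : loc.IsMedianLocalizer C) (hmin : 0 < σmin)
    (hmm : σmin ≤ σmax) (hml : σmax ≤ lam) (hr : 0 < r) (hδ : 0 < δ) (hδ1 : δ < 1) :
    IsPAC (adaptiveEstimator loc r δ lam σmin σmax) (bandFamily lam σmin σmax)
      (fun D => r * stdDev D) δ := by
  have hlam : 0 < lam := by linarith
  set T := gridT σmin σmax with hT
  have hT1 : (1 : ℝ) ≤ T + 1 := by
    have : (0 : ℝ) ≤ T := Nat.cast_nonneg _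
    linarith
  have hδ' : 0 < δ / (T + 1) := by positivity
  have hδ1' : δ / (T + 1) < 1 := by
    rw [div_lt_one (by positivity)]
    linarith
  have hrun : ∀ i, Measurable (gridRun loc r δ lam σmin σmax i).run := fun i =>
    measurable_run_mainEstimator (hloc lam (gridσ σmin i) (δ / (T + 1) / 2) hlam
      (gridσ_pos hmin i) (by linarith) (by linarith)).2.1
  have hm : Measurable (adaptiveEstimator loc r δ lam σmin σmax).run := by
    refine Protocol.JointlyMeasurable.measurable_run (Θ := Unit)
      (p := fun _ => adaptiveEstimator loc r δ lam σmin σmax) ?_ ()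
    refine Protocol.JointlyMeasurable.map
      (p := fun _ => Protocol.collect (gridRun loc r δ lam σmin σmax) (T + 1))
      (Protocol.jointlyMeasurable_const ?_) ((measurable_apply_iStar T).comp measurable_snd)
    exact (Protocol.JointlyMeasurable.collect (Θ := Unit)
      (p := fun i _ => gridRun loc r δ lam σmin σmax i) (T + 1) fun i _ =>
        Protocol.jointlyMeasurable_const (hrun i)).measurable_run ()
  refine ⟨hm, fun D hD => Protocol.prob_ge_of_pr_compl_le D hm
    (measurableSet_le (by fun_prop) measurable_const) hδ.le ?_⟩
  obtain ⟨i₀, hi₀, h1, h2⟩ := exists_grid_index hmin hmm hD.2.2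
  refine (Protocol.pr_map D _ _ _).le.trans ((Protocol.pr_mono D
    (B := {v | ∃ i < T + 1, v i ∈
      (if i₀ ≤ i then {y | gridε r σmin i < |y - mean D|} else ∅ : Set ℝ)})
    (fun v hv => ?_) _).trans ((Protocol.pr_collect_le D _ _ _).trans
      ((Finset.sum_le_sum (g := fun _ => ENNReal.ofReal (δ / (T + 1))) fun i _ => ?_).trans ?_)))
  · by_contra hv'
    refine hv (abs_apply_iStar_sub_le hr hmin hi₀ h2 fun i hi hiT => ?_)
    by_contra! h
    exact hv' ⟨i, by omega, by rw [if_pos hi]; exact h⟩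
  · split_ifs with hi
    · exact pr_mainEstimator_le hloc hlam (gridσ_pos hmin i)
        ⟨hD.1, hD.2.1, h1.trans (gridσ_mono hmin hi)⟩ (gridε_pos hr hmin i) hδ' hδ1'
    · rw [Protocol.pr, indicator_empty]
      exact (Protocol.expect_const D 0 _).le.trans zero_le
  · rw [Finset.sum_const, Finset.card_range, nsmul_eq_mul, ← ENNReal.ofReal_natCast,
      ← ENNReal.ofReal_mul (Nat.cast_nonneg _)]
    refine ENNReal.ofReal_le_ofReal (le_of_eq ?_)
    push_cast
    field_simp
    rfl

end Adaptive

/-! ### Sample complexity -/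

section Complexity

theorem one_le_logp (x : ℝ) : 1 ≤ logp x := le_max_left _ _

theorem log_le_logp (x : ℝ) : Real.log x ≤ logp x := le_max_right _ _

theorem logp_mono {x y : ℝ} (hx : 0 < x) (h : x ≤ y) : logp x ≤ logp y :=
  max_le_max le_rfl (Real.log_le_log hx h)

theorem total_le {N : ℕ → ℕ} {b : ℝ} {k : ℕ} (h : ∀ i < k, (N i : ℝ) ≤ b) :
    (Protocol.total N k : ℝ) ≤ k * b := by
  induction k with
  | zero => simp [Protocol.total]
  | succ k ih =>
    have h1 := h k (by omega)
    have h2 := ih fun i hi => h i (by omega)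
    rw [Protocol.total]
    push_cast
    linarith

theorem bp_le_two_pow (i : ℕ) : bp i ≤ 2 ^ i := by
  rcases lt_or_ge i 4 with h | h
  · rcases Nat.eq_zero_or_pos i with rfl | h0
    · norm_num [bp_zero]
    · exact (bp_of_le_four h0 h.le).le
  · obtain ⟨k, rfl⟩ := Nat.exists_eq_add_of_le' h
    rw [bp_add_four, pow_add]
    have : (1 : ℝ) ≤ 2 ^ k := one_le_pow₀ (by norm_num)
    linarith

theorem half_lt_log_two : 1 / 2 < Real.log 2 := by linarith [Real.log_two_gt_d9]

theorem iMax_le {r σ : ℝ} (hr : 0 < r) (hr1 : r ≤ 1) (hσ : 0 < σ) :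
    (iMax (r * σ / 5) σ : ℝ) ≤ 10 * logp (1 / r) ∧ (2 : ℝ) ^ iMax (r * σ / 5) σ ≤ 256 / r := by
  set y := Real.logb 2 (128 / r) with hy
  have hr' : 1 ≤ 1 / r := by rw [le_div_iff₀ hr]; linarith
  have h2y : (2 : ℝ) ^ y = 128 / r := Real.rpow_logb (by norm_num) (by norm_num) (by positivity)
  have hy7 : y = 7 + Real.logb 2 (1 / r) := by
    rw [hy, show 128 / r = 2 ^ (7 : ℝ) * (1 / r) by norm_num [div_eq_mul_inv],
      Real.logb_mul (by positivity) (by positivity),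
      Real.logb_rpow (by norm_num) (by norm_num)]
  have hlog0 : 0 ≤ Real.log (1 / r) := Real.log_nonneg hr'
  have hl0 : 0 ≤ Real.logb 2 (1 / r) := Real.logb_nonneg (by norm_num) hr'
  have hl1 : Real.logb 2 (1 / r) ≤ 2 * logp (1 / r) := by
    rw [Real.logb, div_le_iff₀ (by linarith [half_lt_log_two])]
    have h1 := log_le_logp (1 / r)
    have h2 := one_le_logp (1 / r)
    nlinarith [half_lt_log_two]
  have hn1 := Nat.le_ceil y
  have hn2 := Nat.ceil_lt_add_one (show 0 ≤ y by linarith)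
  have hle : iMax (r * σ / 5) σ ≤ ⌈y⌉₊ := by
    refine Nat.sInf_le ⟨?_, ?_⟩
    · have : (5 : ℝ) ≤ ⌈y⌉₊ := by linarith
      exact_mod_cast this
    · have h1 : 128 / r ≤ 2 ^ ⌈y⌉₊ := by
        rw [← h2y, ← Real.rpow_natCast]
        exact Real.rpow_le_rpow_of_exponent_le (by norm_num) hn1
      rw [show 5 * (r * σ / 5) / (128 * σ) = (128 / r)⁻¹ by field_simp]
      exact inv_anti₀ (by positivity) h1
  have hle' : (iMax (r * σ / 5) σ : ℝ) ≤ ⌈y⌉₊ := by exact_mod_cast hle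
  constructor
  · linarith [one_le_logp (1 / r)]
  · calc (2 : ℝ) ^ iMax (r * σ / 5) σ ≤ 2 ^ ⌈y⌉₊ := pow_le_pow_right₀ (by norm_num) hle
      _ ≤ 2 ^ (y + 1) := by
        rw [← Real.rpow_natCast]
        exact Real.rpow_le_rpow_of_exponent_le (by norm_num) hn2.le
      _ = 256 / r := by
        rw [Real.rpow_add (by norm_num), h2y, Real.rpow_one]
        ring

theorem one_le_log_two_div_deltaReg {ε δ σ : ℝ} (hε : 0 < ε) (hσ : 0 < σ) (hδ : 0 < δ)
    (hδ1 : δ < 1) : 1 ≤ Real.log (2 / deltaReg ε δ σ) := by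
  have h5 : (5 : ℝ) ≤ iMax ε σ := by exact_mod_cast (iMax_spec hε hσ).1
  have hd := deltaReg_pos hε hσ hδ
  rw [Real.le_log_iff_exp_le (by positivity), le_div_iff₀ hd]
  have h1 : deltaReg ε δ σ ≤ 1 / 40 := by
    unfold deltaReg
    rw [div_le_div_iff₀ (by linarith) (by norm_num)]
    linarith
  have h2 := Real.exp_one_lt_d9
  nlinarith [Real.exp_pos 1]

/-- For the near regions `|aᵢ| + |bᵢ| = O(σ)`. For the far ones the factor `bp |i| ^ 2` in
`1 / epsReg ^ 2` cancels against the variance, and in `1 / epsReg` it is `O(1 / r)`. -/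
theorem nReg_le {r δ σ : ℝ} (hr : 0 < r) (hr1 : r ≤ 1) (hσ : 0 < σ) (hδ : 0 < δ) (hδ1 : δ < 1)
    {i : ℤ} (hi : i ≠ 0) (hi' : i.natAbs ≤ iMax (r * σ / 5) σ) :
    (nReg (r * σ / 5) δ σ i : ℝ) ≤ 300000 * (iMax (r * σ / 5) σ : ℝ) ^ 2 / r ^ 2 *
      Real.log (2 / deltaReg (r * σ / 5) δ σ) := by
  have hε : 0 < r * σ / 5 := by positivity
  have hΛ := one_le_log_two_div_deltaReg hε hσ hδ hδ1
  have heps := epsReg_pos hε hσ hi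
  have h5 : (5 : ℝ) ≤ iMax (r * σ / 5) σ := by exact_mod_cast (iMax_spec hε hσ).1
  have hI2 := (iMax_le hr hr1 hσ).2
  have hb := bp_pos (i := i.natAbs) (by omega)
  have hb2 := bp_strictMono (show i.natAbs - 1 < i.natAbs by omega)
  have hb3 : bp i.natAbs ≤ 256 / r :=
    (bp_le_two_pow _).trans ((pow_le_pow_right₀ (by norm_num) hi').trans hI2)
  have hb4 : i.natAbs ≤ 4 → bp i.natAbs ≤ 16 := fun h =>
    (bp_le_two_pow _).trans ((pow_le_pow_right₀ (by norm_num) h).trans (by norm_num))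
  set I : ℝ := Nat.cast (iMax (r * σ / 5) σ) with hI
  set Λ := Real.log (2 / deltaReg (r * σ / 5) δ σ) with hΛd
  set b := bp i.natAbs with hbd
  have hinv : 1 / epsReg (r * σ / 5) σ i ≤ 40 * I * b / r := by
    rw [epsReg, abs_lo_add_abs_hi hσ hi, ← hI, one_div_div]
    have : (bp (i.natAbs - 1) + b) * σ ≤ 2 * b * σ := by
      gcongr
      linarith
    calc 4 * I * ((bp (i.natAbs - 1) + b) * σ) / (r * σ / 5)
        ≤ 4 * I * (2 * b * σ) / (r * σ / 5) := by gcongr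
      _ = 40 * I * b / r := by field_simp; norm_num
  have hinv0 : 0 ≤ 1 / epsReg (r * σ / 5) σ i := by positivity
  have hI1 : 1 ≤ I ^ 2 / r ^ 2 := by
    rw [le_div_iff₀ (by positivity)]
    nlinarith
  set X := I ^ 2 / r ^ 2 with hX
  have hgoal : 300000 * I ^ 2 / r ^ 2 * Λ = 300000 * X * Λ := by rw [hX]; ring
  rw [hgoal]
  have hXΛ : 1 ≤ X * Λ := one_le_mul_of_one_le_of_one_le hI1 hΛ
  -- The rounding up costs at most one more sample, which is absorbed by `1 ≤ X * Λ`.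
  have hfin : ∀ y : ℝ, 0 ≤ y → y ≤ 204800 * X * Λ → (⌈y⌉₊ : ℝ) ≤ 300000 * X * Λ := by
    intro y hy0 hy
    have := Nat.ceil_lt_add_one hy0
    nlinarith
  rw [nReg]
  split_ifs with h
  · refine hfin _ (by positivity) ?_
    refine mul_le_mul_of_nonneg_right ?_ (by linarith)
    calc 1 / (2 * epsReg (r * σ / 5) σ i ^ 2) = (1 / epsReg (r * σ / 5) σ i) ^ 2 / 2 := by
          field_simp
      _ ≤ (40 * I * 16 / r) ^ 2 / 2 := by
          have := hinv.trans (show 40 * I * b / r ≤ 40 * I * 16 / r by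
            have := hb4 h
            gcongr)
          gcongr
      _ = 204800 * X := by rw [hX, div_pow, mul_pow, mul_pow]; ring
  · refine hfin _ (by positivity) ?_
    refine mul_le_mul_of_nonneg_right ?_ (by linarith)
    have h1 : 8 / b ^ 2 * (1 / epsReg (r * σ / 5) σ i ^ 2) ≤ 12800 * X := by
      calc 8 / b ^ 2 * (1 / epsReg (r * σ / 5) σ i ^ 2)
          = 8 / b ^ 2 * (1 / epsReg (r * σ / 5) σ i) ^ 2 := by rw [div_pow, one_pow]
        _ ≤ 8 / b ^ 2 * (40 * I * b / r) ^ 2 := by gcongr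
        _ = 12800 * X := by rw [hX]; field_simp; norm_num
    have h2 : 2 / 3 * (1 / epsReg (r * σ / 5) σ i) ≤ 7000 * X := by
      calc 2 / 3 * (1 / epsReg (r * σ / 5) σ i) ≤ 2 / 3 * (40 * I * b / r) := by gcongr
        _ ≤ 2 / 3 * (40 * I * (256 / r) / r) := by gcongr
        _ = 2 / 3 * 10240 * (I / r ^ 2) := by field_simp; norm_num
        _ ≤ 2 / 3 * 10240 * X := by
          rw [hX]
          gcongr
          nlinarith
        _ ≤ 7000 * X := by nlinarith
    linarith

theorem refineSize_le {r δ σ : ℝ} (hr : 0 < r) (hr1 : r ≤ 1) (hσ : 0 < σ) (hδ : 0 < δ)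
    (hδ1 : δ < 1) :
    (refineSize (r * σ / 5) δ σ : ℝ) ≤ 1200000000 * (logp (1 / r) ^ 3 / r ^ 2) *
      Real.log (2 / deltaReg (r * σ / 5) δ σ) := by
  have hε : 0 < r * σ / 5 := by positivity
  have hΛ := one_le_log_two_div_deltaReg hε hσ hδ hδ1
  have hI := (iMax_le hr hr1 hσ).1
  have h1 := total_le (N := nPair (r * σ / 5) δ σ) (k := iMax (r * σ / 5) σ)
    (b := 4 * (300000 * (iMax (r * σ / 5) σ : ℝ) ^ 2 / r ^ 2 *
      Real.log (2 / deltaReg (r * σ / 5) δ σ))) fun j hj => by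
    have hp := nReg_le hr hr1 hσ hδ hδ1 (i := j + 1) (by omega) (by rw [natAbs_succ]; omega)
    have hn := nReg_le hr hr1 hσ hδ hδ1 (i := -(j + 1)) (by omega)
      (by rw [natAbs_neg_succ]; omega)
    rw [nPair]
    push_cast
    linarith
  rw [refineSize]
  refine h1.trans ?_
  have h3 : (iMax (r * σ / 5) σ : ℝ) ^ 3 ≤ (10 * logp (1 / r)) ^ 3 := by gcongr
  set I : ℝ := Nat.cast (iMax (r * σ / 5) σ)
  set Λ := Real.log (2 / deltaReg (r * σ / 5) δ σ)
  calc I * (4 * (300000 * I ^ 2 / r ^ 2 * Λ)) = 1200000 * (I ^ 3 / r ^ 2) * Λ := by ring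
    _ ≤ 1200000 * ((10 * logp (1 / r)) ^ 3 / r ^ 2) * Λ := by gcongr
    _ = 1200000000 * (logp (1 / r) ^ 3 / r ^ 2) * Λ := by ring

theorem gridT_add_one_le {σmin σmax : ℝ} (hmin : 0 < σmin) (hmm : σmin ≤ σmax) :
    (gridT σmin σmax : ℝ) + 1 ≤ 4 * logp (σmax / σmin) := by
  have h1 : 1 ≤ σmax / σmin := by rwa [le_div_iff₀ hmin, one_mul]
  have h0 := Real.logb_nonneg (b := 2) (by norm_num) h1
  have h2 := Nat.ceil_lt_add_one h0
  have h3 : Real.logb 2 (σmax / σmin) ≤ 2 * logp (σmax / σmin) := by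
    rw [Real.logb, div_le_iff₀ (by linarith [half_lt_log_two])]
    have h1 := log_le_logp (σmax / σmin)
    have h2 := one_le_logp (σmax / σmin)
    nlinarith [half_lt_log_two]
  rw [gridT]
  linarith [one_le_logp (σmax / σmin)]

theorem log_const_mul_le {c x y : ℝ} (hc : 0 < c) (hx : 0 < x) (hy : 0 < y) {a : ℝ}
    (hca : Real.log c ≤ a) (h : y ≤ c * x) : Real.log y ≤ a + logp x := by
  have := Real.log_le_log hy h
  rw [Real.log_mul hc.ne' hx.ne'] at this
  linarith [log_le_logp x]

theorem log_le_of_le_two_pow {c : ℝ} (hc : 0 < c) (n : ℕ) (h : c ≤ 2 ^ n) :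
    Real.log c ≤ n := by
  have h1 := Real.log_le_log hc h
  rw [Real.log_pow] at h1
  have h2 : Real.log 2 ≤ 1 := by linarith [Real.log_two_lt_d9]
  nlinarith [Nat.cast_nonneg (α := ℝ) n]

/-- Since `σmax ≤ lam`, the ratio `lam / σmin` is at most the square of `lam / √(σmin * σmax)`. -/
theorem logp_div_gridσ_le {lam σmin σmax : ℝ} (hmin : 0 < σmin) (hmm : σmin ≤ σmax)
    (hml : σmax ≤ lam) (i : ℕ) :
    logp (lam / gridσ σmin i) ≤ 2 * logp (lam / √(σmin * σmax)) := by
  have hmax : 0 < σmax := by linarith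
  have hlam : 0 < lam := by linarith
  set s := √(σmin * σmax) with hs
  have hs0 : 0 < s := Real.sqrt_pos.2 (by positivity)
  have hss : s ^ 2 = σmin * σmax := Real.sq_sqrt (by positivity)
  have hgrid : σmin ≤ gridσ σmin i := by
    have := gridσ_mono hmin (Nat.zero_le i)
    rwa [gridσ, pow_zero, mul_one] at this
  have h1 : lam / gridσ σmin i ≤ (lam / s) ^ 2 := by
    rw [div_pow, hss]
    calc lam / gridσ σmin i ≤ lam / σmin := by gcongr
      _ = lam * σmax / (σmin * σmax) := by field_simp
      _ ≤ lam ^ 2 / (σmin * σmax) := by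
        rw [sq]
        gcongr
  have h2 : Real.log (lam / gridσ σmin i) ≤ 2 * Real.log (lam / s) := by
    have := Real.log_le_log (div_pos hlam (gridσ_pos hmin i)) h1
    rwa [Real.log_pow] at this
  refine max_le ?_ ?_
  · linarith [one_le_logp (lam / s)]
  · linarith [log_le_logp (lam / s)]

theorem gridSize_le {C lam σmin σmax r δ : ℝ} (hC : 0 ≤ C)
    (hsize : ∀ lam σ δ : ℝ, 0 < lam → 0 < σ → 0 < δ → δ < 1 →
      (searchLocalizer.size lam σ δ : ℝ) ≤ C * (logp (lam / σ) + logp (1 / δ)))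
    (hmin : 0 < σmin) (hmm : σmin ≤ σmax) (hml : σmax ≤ lam) (hr : 0 < r) (hr1 : r ≤ 1)
    (hδ : 0 < δ) (hδ1 : δ < 1) (i : ℕ) :
    (gridSize searchLocalizer r δ lam σmin σmax i : ℝ) ≤
      (13200000000 + 4 * C) * (logp (1 / r) ^ 3 / r ^ 2 *
        logp (logp (σmax / σmin) * logp (1 / r) / δ) + logp (lam / √(σmin * σmax))) := by
  have hσ := gridσ_pos hmin i
  have hlam : 0 < lam := by linarith
  have hT := gridT_add_one_le hmin hmm
  have hT0 : (1 : ℝ) ≤ gridT σmin σmax + 1 := by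
    linarith [Nat.cast_nonneg (α := ℝ) (gridT σmin σmax)]
  have hδ' : 0 < δ / (gridT σmin σmax + 1) := by positivity
  have hδ1' : δ / (gridT σmin σmax + 1) < 1 := by
    rw [div_lt_one (by positivity)]
    linarith
  have href := refineSize_le hr hr1 hσ hδ' hδ1'
  have hloc := hsize lam (gridσ σmin i) (δ / (gridT σmin σmax + 1) / 2) hlam hσ (by linarith)
    (by linarith)
  have hε : 0 < r * gridσ σmin i / 5 := by positivity
  have hI := (iMax_le hr hr1 hσ).1
  have hI0 := iMax_pos hε hσ
  have hz := logp_div_gridσ_le hmin hmm hml i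
  have hL := one_le_logp (σmax / σmin)
  have hρ := one_le_logp (1 / r)
  rw [gridSize, mainSize, gridε]
  push_cast
  set L := logp (σmax / σmin)
  set ρ := logp (1 / r)
  set Z := logp (lam / √(σmin * σmax)) with hZ
  set τ : ℝ := gridT σmin σmax + 1 with hτ
  set I : ℝ := Nat.cast (iMax (r * gridσ σmin i / 5) (gridσ σmin i)) with hId
  have hx : 0 < L * ρ / δ := by positivity
  have hY := one_le_logp (L * ρ / δ)
  have hΛ : Real.log (2 / deltaReg (r * gridσ σmin i / 5) (δ / τ) (gridσ σmin i)) ≤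
      11 * logp (L * ρ / δ) := by
    have e : 2 / deltaReg (r * gridσ σmin i / 5) (δ / τ) (gridσ σmin i) = 16 * I * τ / δ := by
      rw [deltaReg, ← hId]
      field_simp
      norm_num
    have h1 : 16 * I * τ / δ ≤ 640 * (L * ρ / δ) := by
      rw [mul_div_assoc']
      refine div_le_div_of_nonneg_right ?_ hδ.le
      calc 16 * I * τ ≤ 16 * (10 * ρ) * (4 * L) := by gcongr
        _ = 640 * (L * ρ) := by ring
    rw [e]
    have h2 := log_const_mul_le (a := (10 : ℕ)) (by norm_num) hx (by positivity)
      (log_le_of_le_two_pow (by norm_num) 10 (by norm_num)) h1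
    push_cast at h2
    linarith
  have hlogδ : logp (1 / (δ / τ / 2)) ≤ 4 * logp (L * ρ / δ) := by
    refine max_le (by linarith) ?_
    have h1 : 1 / (δ / τ / 2) ≤ 8 * (L * ρ / δ) := by
      rw [show 1 / (δ / τ / 2) = 2 * τ / δ by field_simp, mul_div_assoc']
      refine div_le_div_of_nonneg_right ?_ hδ.le
      nlinarith
    have h2 := log_const_mul_le (a := (3 : ℕ)) (by norm_num) hx (by positivity)
      (log_le_of_le_two_pow (by norm_num) 3 (by norm_num)) h1
    push_cast at h2
    linarith
  have hP : 1 ≤ ρ ^ 3 / r ^ 2 := by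
    rw [le_div_iff₀ (by positivity)]
    have h1 : r ^ 2 ≤ 1 := pow_le_one₀ hr.le hr1
    have h2 : 1 ≤ ρ ^ 3 := one_le_pow₀ hρ
    linarith
  have hZ1 : 1 ≤ Z := one_le_logp _
  set P := ρ ^ 3 / r ^ 2
  set Y := logp (L * ρ / δ)
  have h1 : 1200000000 * P * Real.log (2 / deltaReg (r * gridσ σmin i / 5) (δ / τ)
      (gridσ σmin i)) ≤ 1200000000 * P * (11 * Y) := by gcongr
  have h2 : C * (logp (lam / gridσ σmin i) + logp (1 / (δ / τ / 2))) ≤ C * (2 * Z + 4 * Y) := by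
    gcongr
  have h3 : Y ≤ P * Y := le_mul_of_one_le_left (by linarith) hP
  have h4 : C * (2 * Z + 4 * Y) ≤ 4 * C * (P * Y + Z) := by nlinarith
  nlinarith

theorem exists_adaptiveSize_le :
    ∃ C : ℝ, 0 ≤ C ∧ ∀ lam σmin σmax r δ : ℝ,
      0 < σmin → σmin ≤ σmax → σmax ≤ lam → 0 < r → r ≤ 1 → 0 < δ → δ < 1 →
      (adaptiveSize searchLocalizer r δ lam σmin σmax : ℝ) ≤
        C * (logp (σmax / σmin) * logp (1 / r) ^ 3 / r ^ 2 *
              logp (logp (σmax / σmin) * logp (1 / r) / δ) +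
            logp (σmax / σmin) * logp (lam / √(σmin * σmax))) := by
  obtain ⟨C, hC0, hC⟩ := localizer_size_le
  refine ⟨4 * (13200000000 + 4 * C), by positivity,
    fun lam σmin σmax r δ hmin hmm hml hr hr1 hδ hδ1 => ?_⟩
  have h1 := total_le (N := gridSize searchLocalizer r δ lam σmin σmax)
    (k := gridT σmin σmax + 1) fun i _ => gridSize_le hC0 hC hmin hmm hml hr hr1 hδ hδ1 i
  rw [adaptiveSize]
  refine h1.trans ?_
  have hT := gridT_add_one_le hmin hmm
  have hρ := one_le_logp (1 / r)
  have hY := one_le_logp (logp (σmax / σmin) * logp (1 / r) / δ)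
  have hZ := one_le_logp (lam / √(σmin * σmax))
  push_cast
  calc _ ≤ 4 * logp (σmax / σmin) * ((13200000000 + 4 * C) * (logp (1 / r) ^ 3 / r ^ 2 *
        logp (logp (σmax / σmin) * logp (1 / r) / δ) + logp (lam / √(σmin * σmax)))) := by
        gcongr
    _ = _ := by ring

/-- The first bound is at most the second one, up to polylogarithmic factors. -/
theorem sampleBound_le_mul_logp_pow {L r δ Z B : ℝ} (hL : 1 ≤ L) (hr : 0 < r) (hr1 : r ≤ 1)
    (hδ : 0 < δ) (hZ : 1 ≤ Z) (hB : B = L * (1 / r ^ 2 * logp (1 / δ) + Z)) :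
    L * logp (1 / r) ^ 3 / r ^ 2 * logp (L * logp (1 / r) / δ) + L * Z ≤
      4 * B * logp B ^ 4 := by
  have hρ := one_le_logp (1 / r)
  have hΔ := one_le_logp (1 / δ)
  have hb := one_le_logp B
  have hr2 : 1 ≤ 1 / r ^ 2 := by
    rw [le_div_iff₀ (by positivity), one_mul]
    exact pow_le_one₀ hr.le hr1
  have hrr : 1 / r ≤ 1 / r ^ 2 := one_div_le_one_div_of_le (by positivity) (by nlinarith)
  set Δ := logp (1 / δ)
  set b := logp B
  have hB1 : L * (1 / r ^ 2) * Δ ≤ B := by rw [hB]; nlinarith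
  have hB2 : L * Z ≤ B := by
    have : 0 ≤ 1 / r ^ 2 * Δ := by positivity
    rw [hB]
    nlinarith
  have hrB : 1 / r ^ 2 ≤ B := by
    refine le_trans ?_ hB1
    have : 1 / r ^ 2 ≤ L * (1 / r ^ 2) := le_mul_of_one_le_left (by positivity) hL
    exact this.trans (le_mul_of_one_le_right (by positivity) hΔ)
  have hLB : L ≤ B := by nlinarith
  have hB0 : 0 < B := by linarith
  have hρb : logp (1 / r) ≤ b := logp_mono (by positivity) (hrr.trans hrB)
  have hY : logp (L * logp (1 / r) / δ) ≤ 3 * (b * Δ) := by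
    have hbΔ : b ≤ b * Δ := le_mul_of_one_le_right (by linarith) hΔ
    have hΔb : Δ ≤ b * Δ := le_mul_of_one_le_left (by linarith) hb
    refine max_le (by linarith) ?_
    rw [← mul_one_div, Real.log_mul (by positivity) (by positivity),
      Real.log_mul (by positivity) (by positivity)]
    have h1 : Real.log L ≤ b := (Real.log_le_log (by linarith) hLB).trans (log_le_logp B)
    have h2 : Real.log (logp (1 / r)) ≤ b :=
      (Real.log_le_sub_one_of_pos (by linarith)).trans (by linarith)
    have h3 : Real.log (1 / δ) ≤ Δ := log_le_logp _
    linarith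
  have hb4 : 1 ≤ b ^ 4 := one_le_pow₀ hb
  have hY0 : 0 ≤ logp (L * logp (1 / r) / δ) := by linarith [one_le_logp (L * logp (1 / r) / δ)]
  calc L * logp (1 / r) ^ 3 / r ^ 2 * logp (L * logp (1 / r) / δ) + L * Z
      ≤ L * b ^ 3 / r ^ 2 * (3 * (b * Δ)) + B := by gcongr
    _ = 3 * (L * (1 / r ^ 2) * Δ) * b ^ 4 + B := by ring
    _ ≤ 3 * B * b ^ 4 + B := by gcongr
    _ ≤ 4 * B * b ^ 4 := by nlinarith

end Complexity

end OneBit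

end

theorem theorem7 :
    ∃ loc : OneBit.Localizer,
      (∃ C : ℝ, loc.IsMedianLocalizer C) ∧
      -- correctness
      (∀ lam σmin σmax r δ : ℝ, 0 < σmin → σmin ≤ σmax → σmax ≤ lam → 0 < r → 0 < δ → δ < 1 →
        OneBit.IsPAC (OneBit.adaptiveEstimator loc r δ lam σmin σmax)
          (OneBit.bandFamily lam σmin σmax) (fun D => r * OneBit.stdDev D) δ) ∧
      -- sample complexity
      (∃ C : ℝ, ∀ lam σmin σmax r δ : ℝ,
        0 < σmin → σmin ≤ σmax → σmax ≤ lam → 0 < r → r ≤ 1 → 0 < δ → δ < 1 →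
        (OneBit.adaptiveSize loc r δ lam σmin σmax : ℝ) ≤
          C * (OneBit.logp (σmax / σmin) * OneBit.logp (1 / r) ^ 3 / r ^ 2 *
                OneBit.logp (OneBit.logp (σmax / σmin) * OneBit.logp (1 / r) / δ) +
              OneBit.logp (σmax / σmin) * OneBit.logp (lam / √(σmin * σmax)))) ∧
      -- the same bound up to polylogarithmic factors
      (∃ (C : ℝ) (k : ℕ), ∀ lam σmin σmax r δ B : ℝ,
        0 < σmin → σmin ≤ σmax → σmax ≤ lam → 0 < r → r ≤ 1 → 0 < δ → δ < 1 →
        B = OneBit.logp (σmax / σmin) *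
          (1 / r ^ 2 * OneBit.logp (1 / δ) + OneBit.logp (lam / √(σmin * σmax))) →
        (OneBit.adaptiveSize loc r δ lam σmin σmax : ℝ) ≤ C * B * OneBit.logp B ^ k) := by
  obtain ⟨C₀, hC₀⟩ := OneBit.isMedianLocalizer_searchLocalizer
  obtain ⟨C, hC0, hC⟩ := OneBit.exists_adaptiveSize_le
  refine ⟨OneBit.searchLocalizer, ⟨C₀, hC₀⟩, ?_, ⟨C, hC⟩, C * 4, 4, ?_⟩
  · intro lam σmin σmax r δ hmin hmm hml hr hδ hδ1
    exact OneBit.isPAC_adaptiveEstimator hC₀ hmin hmm hml hr hδ hδ1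
  · intro lam σmin σmax r δ B hmin hmm hml hr hr1 hδ hδ1 hB
    refine (hC lam σmin σmax r δ hmin hmm hml hr hr1 hδ hδ1).trans ?_
    rw [mul_assoc C, mul_assoc C]
    exact mul_le_mul_of_nonneg_left (OneBit.sampleBound_le_mul_logp_pow (OneBit.one_le_logp _)
      hr hr1 hδ (OneBit.one_le_logp _) hB) hC0
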